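/- Let $N\ge 1$ and let $\alpha_1=1,\alpha_2,\dots,\alpha_N$ be non-zero real numbers. Let $H_n$ denote the Hermite polynomials, $\sum_{n\ge0}H_n(x)\frac{t^n}{n!}=e^{2xt-t^2}$, let $L(x)$ be the lower triangular $N\times N$ matrix with $L(x)_{m,n}=\frac{H_{m-n}(x)}{(m-n)!}$ for $m\ge n$, put $S^\alpha=\operatorname{diag}(\alpha_1,\dots,\alpha_N)$ and $L^\alpha(x)=S^\alpha L(x)(S^\alpha)^{-1}$. For real $\mu$ let $$W^{(\alpha,\mu)}(x)=L^\alpha(x)\,e^{-x^2}\operatorname{diag}\bigl(\delta^{(\mu)}_1,\dots,\delta^{(\mu)}_N\bigr)\,L^\alpha(x)^\ast ,\qquad x\in\mathbb R,$$ with real parameters $\delta^{(\mu)}_k$, and let $c^{(\mu)},d^{(\mu)}$ be real numbers. Let $\nu,\lambda\in\mathbb R$ and suppose that for every $\mu$ of the form $\nu+p$ or $\lambda+p$, $p\in\mathbb N=\{0,1,2,\dots\}$, the numbers $\delta^{(\mu)}_k$, $c^{(\mu)}$, $d^{(\mu)}$ are positive and $$\delta^{(\mu+1)}_k=(k\,d^{(\mu)}+c^{(\mu)})\,\delta^{(\mu)}_k\quad(1\le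 k\le N),\qquad \frac{\alpha_{k+1}^2}{\alpha_k^2}=\frac{d^{(\mu)}k(N-k)}{2(d^{(\mu)}k+c^{(\mu)})}\,\frac{\delta^{(\mu)}_{k+1}}{\delta^{(\mu)}_k}\quad(1\le k\le N-1).$$ Write $q_\mu=c^{(\mu)}/d^{(\mu)}$ and $(x)_k=x(x+1)\cdots(x+k-1)$. Then for $\mu=\nu$ and for $\mu=\lambda$ there is a unique sequence $(P^{(\alpha,\mu)}_n)_{n\ge0}$ of monic $N\times N$ matrix polynomials, $P_n^{(\alpha,\mu)}$ of degree $n$, with $\int_{\mathbb R}P^{(\alpha,\mu)}_n(x)W^{(\alpha,\mu)}(x)P^{(\alpha,\mu)}_m(x)^\ast\,dx=0$ for $m\ne n$, and for all $n\in\mathbb N$ $$P_n^{(\alpha,\nu)}(x)=\sum_{k=0}^{N}A^{(\nu,\lambda)}_k(n)\,P^{(\alpha,\lambda)}_{n-k}(x)\qquad(P^{(\alpha,\lambda)}_{j}=0\text{ for }j<0),$$ where $A^{(\nu,\lambda)}_k(n)_{r,t}=0$ unless $t=r+k$, and for $k\le n$, $1\le r\le N-k$, $$\begin{aligned} A^{(\nu,\lambda)}_k(n)_{r,r+k}={}&2^{-k}\,\frac{\alpha_r}{\alpha_{r+k}}\,(r)_k\,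 \prod_{p=0}^{n-1}\frac{1+q_{\nu+p}}{N-r+1+q_{\nu+p}}\; \prod_{p=0}^{n-k-1}\frac{N-r-k+1+q_{\lambda+p}}{1+q_{\lambda+p}}\\ &\times\binom{N-r}{k}\,(q_\nu-q_\lambda)_k\, \frac{(q_\lambda+1)_{N-r-k}}{(q_\nu+1)_{N-r}}\; \frac{N-r-2k+n+1+q_\lambda}{N-r-k+n+1+q_\lambda}\\ &\times\frac{(-1)^k(-n)_k\,(n+1+q_\nu)_{N-r-k}}{(n-k+1+q_\lambda)_{N-r}} . \end{aligned}$$ -/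

import Mathlib

open Polynomial Matrix

namespace MVHermite

noncomputable section

/-- The (physicists') Hermite polynomials `H_n`, with `H_0 = 1` and `H_{n+1} = 2 x H_n - H_n'`;
equivalently `∑ H_n(x) t ^ n / n! = exp (2 x t - t ^ 2)`. -/
def hermiteH : ℕ → ℝ[X]
  | 0 => 1
  | n + 1 => 2 * X * hermiteH n - derivative (hermiteH n)

/-!
Parameters `α_1, …, α_N` and `δ_1, …, δ_N` are modelled by functions on `ℕ`, of which only the
values at `1, …, N` are used. The entry of a matrix in row `m` and column `n` (`1 ≤ m, n ≤ N`) is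
the entry at the elements of `Fin N` with values `m - 1` and `n - 1`.
-/

/-- The unipotent lower triangular Toeplitz matrix `L(x)`, with entries `H_{m-n}(x) / (m-n)!`. -/
def L (N : ℕ) (x : ℝ) : Matrix (Fin N) (Fin N) ℂ :=
  Matrix.of fun i j =>
    if j ≤ i then
      (((hermiteH ((i : ℕ) - (j : ℕ))).eval x / (((i : ℕ) - (j : ℕ)).factorial : ℝ) : ℝ) : ℂ)
    else 0

/-- `S^α = diag(α_1, …, α_N)`. -/
def S (N : ℕ) (α : ℕ → ℝ) : Matrix (Fin N) (Fin N) ℂ :=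
  Matrix.diagonal fun i => ((α ((i : ℕ) + 1) : ℝ) : ℂ)

/-- `L^α(x) = S^α L(x) (S^α)⁻¹`. -/
def Lα (N : ℕ) (α : ℕ → ℝ) (x : ℝ) : Matrix (Fin N) (Fin N) ℂ :=
  S N α * L N x * (S N α)⁻¹

/-- `T(x) = exp(-x²) diag(δ_1, …, δ_N)`. -/
def T (N : ℕ) (δ : ℕ → ℝ) (x : ℝ) : Matrix (Fin N) (Fin N) ℂ :=
  Matrix.diagonal fun i => ((Real.exp (-x ^ 2) * δ ((i : ℕ) + 1) : ℝ) : ℂ)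

/-- The matrix weight `W(x) = L^α(x) T(x) L^α(x)^*` on the real line. -/
def W (N : ℕ) (α δ : ℕ → ℝ) (x : ℝ) : Matrix (Fin N) (Fin N) ℂ :=
  Lα N α x * T N δ x * (Lα N α x)ᴴ

/-- The value `P(x) = ∑ k, a_k x ^ k` at a real point `x` of a matrix polynomial with
coefficients `a_k`. -/
def evalAt {N : ℕ} (P : (Matrix (Fin N) (Fin N) ℂ)[X]) (x : ℝ) : Matrix (Fin N) (Fin N) ℂ :=
  P.eval (Matrix.scalar (Fin N) (x : ℂ))

/-- The matrix valued form `⟨P, Q⟩ = ∫ P(x) W(x) Q(x)^* dx` (entrywise integrals over `ℝ`). -/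
def form {N : ℕ} (W : ℝ → Matrix (Fin N) (Fin N) ℂ) (P Q : (Matrix (Fin N) (Fin N) ℂ)[X]) :
    Matrix (Fin N) (Fin N) ℂ :=
  Matrix.of fun i j => ∫ x : ℝ, (evalAt P x * W x * (evalAt Q x)ᴴ) i j

/-- `P_0, P_1, …` is a sequence of monic orthogonal matrix polynomials, `P_n` of degree `n`,
for the weight `W`. -/
structure IsMonicOrthogonal {N : ℕ} (W : ℝ → Matrix (Fin N) (Fin N) ℂ)
    (P : ℕ → (Matrix (Fin N) (Fin N) ℂ)[X]) : Prop where
  monic : ∀ n, (P n).Monic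
  natDegree_eq : ∀ n, (P n).natDegree = n
  orthogonal : ∀ m n, m ≠ n → form W (P m) (P n) = 0

/-- The standing conditions at the parameter value `μ`: positivity of `δ_k^{(μ)}`, `c^{(μ)}`,
`d^{(μ)}`, the relation `Δ^{(μ+1)} = (d^{(μ)} J + c^{(μ)}) Δ^{(μ)}`, and the relation between
`α` and `δ^{(μ)}`. -/
structure Admissible (N : ℕ) (α : ℕ → ℝ) (δ : ℝ → ℕ → ℝ) (c d : ℝ → ℝ) (μ : ℝ) : Prop where
  δ_pos : ∀ k, 1 ≤ k → k ≤ N → 0 < δ μ k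
  c_pos : 0 < c μ
  d_pos : 0 < d μ
  δ_succ : ∀ k, 1 ≤ k → k ≤ N → δ (μ + 1) k = (k * d μ + c μ) * δ μ k
  α_ratio : ∀ k, 1 ≤ k → k ≤ N - 1 →
    α (k + 1) ^ 2 / α k ^ 2 =
      d μ * k * ((N : ℝ) - k) / (2 * (d μ * k + c μ)) * (δ μ (k + 1) / δ μ k)

/-- The rising factorial `(x)_k = x (x + 1) ⋯ (x + k - 1)`. -/
def poch (x : ℝ) (k : ℕ) : ℝ := (ascPochhammer ℝ k).eval x

/-- The entry `A_k^{(ν, lam)}(n)_{r, r+k}`, where `1 ≤ r`, `r + k ≤ N`, `k ≤ n`, and `q μ`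
stands for `c^{(μ)} / d^{(μ)}`. -/
def connCoeff (N : ℕ) (α : ℕ → ℝ) (q : ℝ → ℝ) (ν lam : ℝ) (n k r : ℕ) : ℝ :=
  ((2 : ℝ) ^ k)⁻¹ * (α r / α (r + k)) * poch r k
    * (∏ p ∈ Finset.range n, (1 + q (ν + p)) / ((N : ℝ) - r + 1 + q (ν + p)))
    * (∏ p ∈ Finset.range (n - k), ((N : ℝ) - r - k + 1 + q (lam + p)) / (1 + q (lam + p)))
    * ((N - r).choose k : ℝ) * poch (q ν - q lam) k
    * (poch (q lam + 1) (N - r - k) / poch (q ν + 1) (N - r))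
    * (((N : ℝ) - r - 2 * k + n + 1 + q lam) / ((N : ℝ) - r - k + n + 1 + q lam))
    * ((-1) ^ k * poch (-(n : ℝ)) k * poch ((n : ℝ) + 1 + q ν) (N - r - k)
        / poch ((n : ℝ) - k + 1 + q lam) (N - r))

/-- The matrix `A_k^{(ν, lam)}(n)`, supported on the `k`-th superdiagonal. -/
def connMatrix (N : ℕ) (α : ℕ → ℝ) (q : ℝ → ℝ) (ν lam : ℝ) (n k : ℕ) :
    Matrix (Fin N) (Fin N) ℂ :=
  Matrix.of fun i j =>
    if (j : ℕ) = (i : ℕ) + k then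
      ((connCoeff N α q ν lam n k ((i : ℕ) + 1) : ℝ) : ℂ)
    else 0

end

end MVHermite

namespace MVHermite

noncomputable section

/-! The monic orthogonal polynomials are written down explicitly, and the connection formula then
becomes a scalar hypergeometric identity.

Let `A` be the subdiagonal shift conjugated by `S^α`. Multiplying `L^α(x)` on the left by `H_m(x -
A)` raises each Hermite index by `m`: the entries become `α_i/α_j · H_{m+i-j}/(i-j)!`
(`evalAt_hermiteShift_mul`). So for `P_n = ∑_t (superdiagonal matrix) · H_{n-t}(x - A)`, each entry
`(i,j)` of `P_n L^α` is a number times the single polynomial `H_{n+i-j}`; apart from `2^{-n}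
α_i/α_j` that number is `hahnVec`. Hermite orthogonality kills the `(i,k)` entry of `⟨P_n, P_m⟩`
unless `n + i = m + k`. On each such line there remains a discrete orthogonality of the vectors
`hahnVec`, which holds because they are eigenvectors, with distinct eigenvalues, of one symmetric
tridiagonal operator (`hahnVec_orthogonal`). The relation between `α` and `δ` says exactly that the
weight in `j` makes this operator symmetric. The matrices `⟨P_n, P_n⟩` are diagonal with nonzero
diagonal, which gives uniqueness.

The polynomials `H_m(x - A)` do not depend on the parameter, so the connection formula follows by
comparing their coefficients (`sum_connMatrix_mul_hahnMatrix`), that is, from the summation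
`sum_wellPoised`. The products over `p` in the stated coefficient collapse because admissibility at
`μ` and `μ + 1` forces `q_{μ+1} = q_μ + 1` when `N ≥ 2` (`Admissible.ratio_succ`). -/

/-! ### Rising and descending factorials and a very-well-poised sum -/

theorem poch_zero (x : ℝ) : poch x 0 = 1 := by simp [poch]

theorem poch_succ (x : ℝ) (k : ℕ) : poch x (k + 1) = poch x k * (x + k) := by
  simp [poch, ascPochhammer_succ_eval]

theorem poch_pos {x : ℝ} (hx : 0 < x) (k : ℕ) : 0 < poch x k := ascPochhammer_pos k x hx

theorem poch_add (x : ℝ) (m n : ℕ) : poch x (m + n) = poch x m * poch (x + m) n := by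
  induction n with
  | zero => simp [poch_zero]
  | succ n ih => rw [← add_assoc, poch_succ, ih, poch_succ]; push_cast; ring

theorem poch_eq_prod (x : ℝ) (k : ℕ) : poch x k = ∏ p ∈ Finset.range k, (x + p) := by
  induction k with
  | zero => simp [poch_zero]
  | succ k ih => rw [poch_succ, ih, Finset.prod_range_succ]

theorem poch_neg_nat (n k : ℕ) : (-1) ^ k * poch (-(n : ℝ)) k = n.descFactorial k := by
  induction k with
  | zero => simp [poch_zero]
  | succ k ih =>
    rw [Nat.descFactorial_succ, Nat.cast_mul, ← ih, poch_succ, pow_succ]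
    rcases le_or_gt k n with h | h
    · rw [Nat.cast_sub h]; ring
    · have h0 : poch (-(n : ℝ)) k = 0 := by
        have : ((n.descFactorial k : ℕ) : ℝ) = 0 := by
          rw [Nat.descFactorial_eq_zero_iff_lt.2 h]; simp
        rw [← ih] at this
        simpa using this
      rw [h0]; ring

/-- The product `(x - 1) (x - 2) ⋯ (x - k)`. -/
def descProd (x : ℝ) (k : ℕ) : ℝ := ∏ p ∈ Finset.range k, (x - (p + 1))

theorem descProd_zero (x : ℝ) : descProd x 0 = 1 := by simp [descProd]

theorem descProd_succ (x : ℝ) (k : ℕ) : descProd x (k + 1) = descProd x k * (x - (k + 1)) := by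
  simp [descProd, Finset.prod_range_succ]

theorem descProd_succ' (x : ℝ) (k : ℕ) : descProd x (k + 1) = (x - 1) * descProd (x - 1) k := by
  rw [descProd, Finset.prod_range_succ', mul_comm]
  congr 1
  · simp
  · refine Finset.prod_congr rfl fun p _ => ?_
    push_cast; ring

theorem descProd_pos {x : ℝ} {k : ℕ} (h : (k : ℝ) < x) : 0 < descProd x k := by
  refine Finset.prod_pos fun p hp => ?_
  have : ((p + 1 : ℕ) : ℝ) ≤ k := by exact_mod_cast Finset.mem_range.1 hp
  push_cast at this
  linarith

theorem descProd_add (x : ℝ) (m n : ℕ) :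
    descProd x (m + n) = descProd x m * descProd (x - m) n := by
  induction n with
  | zero => simp [descProd_zero]
  | succ n ih => rw [← add_assoc, descProd_succ, ih, descProd_succ]; push_cast; ring

theorem poch_eq_descProd (x : ℝ) (k : ℕ) : poch x k = descProd (x + k) k := by
  induction k generalizing x with
  | zero => simp [poch_zero, descProd_zero]
  | succ k ih =>
    rw [poch_succ, descProd_succ', ih]
    push_cast
    rw [show x + (k + 1) - 1 = x + (k : ℝ) by ring]
    ring

/-- A terminating very-well-poised summation. -/
theorem sum_wellPoised (b : ℝ) (T : ℕ) : ∀ z c : ℝ, c = z + b → 2 * (T : ℝ) < z → (T : ℝ) < c →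
    ∑ k ∈ Finset.range (T + 1), (T.choose k : ℝ) * (-1) ^ k * poch b k * (z - 2 * k)
      / (descProd c k * descProd (z - k + 1) (T + 1)) = 1 / descProd c T := by
  induction T with
  | zero =>
    intro z c _ hz _
    have : z ≠ 0 := by norm_num at hz; exact hz.ne'
    simp [poch_zero, descProd, this]
  | succ T ih =>
    intro z c hc hz hcT
    push_cast at hz hcT
    -- Over the common denominator the numerator is `(c - k - 1) - (b + k) = z - 1 - 2k`, since `c =
    -- z + b`. This is the summand for `T`, `z - 1`, `c - 1`, up to the factor `1 / (c - 1)`.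
    have key : ∀ k ∈ Finset.range (T + 1),
        (T.choose k : ℝ) * (-1) ^ k * poch b k / (descProd c k * descProd (z - k) (T + 1))
        + (T.choose k : ℝ) * (-1) ^ (k + 1) * poch b (k + 1)
            / (descProd c (k + 1) * descProd (z - k) (T + 1))
        = 1 / (c - 1) * ((T.choose k : ℝ) * (-1) ^ k * poch b k * (z - 1 - 2 * k)
          / (descProd (c - 1) k * descProd (z - 1 - k + 1) (T + 1))) := by
      intro k hk
      have hk : (k : ℝ) ≤ T := by exact_mod_cast Nat.lt_succ_iff.1 (Finset.mem_range.1 hk)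
      have hT : (0 : ℝ) ≤ T := Nat.cast_nonneg T
      have h1 : descProd (z - k) (T + 1) ≠ 0 := (descProd_pos (by push_cast; linarith)).ne'
      have h2 : descProd c k ≠ 0 := (descProd_pos (by linarith)).ne'
      have h3 : c - (k + 1) ≠ 0 := by
        have : 0 < c - (k + 1) := by linarith
        exact this.ne'
      have h4 : c - 1 ≠ 0 := by
        have : 0 < c - 1 := by linarith
        exact this.ne'
      have h5 : descProd (c - 1) k ≠ 0 := (descProd_pos (by linarith)).ne'
      have h6 : descProd c k * (c - (k + 1)) = (c - 1) * descProd (c - 1) k := by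
        rw [← descProd_succ, descProd_succ']
      rw [descProd_succ c k, h6, poch_succ, show z - 1 - (k : ℝ) + 1 = z - k by ring]
      have h7 : descProd c k = (c - 1) * descProd (c - 1) k / (c - (k + 1)) := by
        rw [← h6]; field_simp
      rw [h7]
      field_simp
      rw [hc]
      ring
    -- Partial fractions: `(T+1)(z - 2k) = (T+1-k)(z-k) + k(z-k-(T+1))`, where `z - k` and `z - k -
    -- (T+1)` are the extreme factors of the descending product. The binomial weights then become
    -- those of `T`, and shifting `k` in the second sum matches the denominators.
    have split : ∀ k ∈ Finset.range (T + 2),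
        ((T + 1).choose k : ℝ) * (-1) ^ k * poch b k * (z - 2 * k)
          / (descProd c k * descProd (z - k + 1) (T + 1 + 1))
        = (((T + 1).choose k : ℝ) * (T + 1 - k) / (T + 1)) * (-1) ^ k * poch b k
            / (descProd c k * descProd (z - k) (T + 1))
          + (((T + 1).choose k : ℝ) * k / (T + 1)) * (-1) ^ k * poch b k
            / (descProd c k * descProd (z - k + 1) (T + 1)) := by
      intro k hk
      have hk : (k : ℝ) ≤ T + 1 := by exact_mod_cast Nat.lt_succ_iff.1 (Finset.mem_range.1 hk)
      have hT : (0 : ℝ) ≤ T := Nat.cast_nonneg T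
      have h1 : descProd (z - k) (T + 1) ≠ 0 := (descProd_pos (by push_cast; linarith)).ne'
      have h2 : descProd c k ≠ 0 := (descProd_pos (by linarith)).ne'
      have h3 : z - k ≠ 0 := by
        have : 0 < z - k := by linarith
        exact this.ne'
      have h4 : descProd (z - k + 1) (T + 1) ≠ 0 :=
        (descProd_pos (by push_cast; linarith)).ne'
      have h8 : z - k - (T + 1) ≠ 0 := by
        have : 0 < z - k - (T + 1) := by linarith
        exact this.ne'
      have h5 : (T : ℝ) + 1 ≠ 0 := by positivity
      have h6 := descProd_succ' (z - k + 1) (T + 1)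
      have h7 := descProd_succ (z - k + 1) (T + 1)
      rw [show z - (k : ℝ) + 1 - 1 = z - k by ring] at h6
      have h9 : descProd (z - k) (T + 1)
          = descProd (z - k + 1) (T + 1) * (z - k - (T + 1)) / (z - k) := by
        rw [eq_div_iff h3, mul_comm, ← h6, h7]; push_cast; ring
      rw [h6, h9]
      field_simp
      ring
    rw [Finset.sum_congr rfl split, Finset.sum_add_distrib]
    have e1 : ∑ k ∈ Finset.range (T + 2), (((T + 1).choose k : ℝ) * (T + 1 - k) / (T + 1))
        * (-1) ^ k * poch b k / (descProd c k * descProd (z - k) (T + 1))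
        = ∑ k ∈ Finset.range (T + 1), (T.choose k : ℝ) * (-1) ^ k * poch b k
          / (descProd c k * descProd (z - k) (T + 1)) := by
      rw [Finset.sum_range_succ]
      have : ((T : ℝ) + 1 - ((T + 1 : ℕ) : ℝ)) = 0 := by push_cast; ring
      rw [this]
      simp only [mul_zero, zero_div, zero_mul, add_zero]
      refine Finset.sum_congr rfl fun k hk => ?_
      congr 3
      have hk : k ≤ T := Nat.lt_succ_iff.1 (Finset.mem_range.1 hk)
      have h := Nat.choose_mul_succ_eq T k
      have h' : (T.choose k : ℝ) * (T + 1) = ((T + 1).choose k : ℝ) * (T + 1 - k) := by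
        rw [← Nat.cast_succ, ← Nat.cast_sub (by omega)]
        exact_mod_cast h
      rw [← h']; field_simp
    have e2 : ∑ k ∈ Finset.range (T + 2), (((T + 1).choose k : ℝ) * k / (T + 1))
        * (-1) ^ k * poch b k / (descProd c k * descProd (z - k + 1) (T + 1))
        = ∑ k ∈ Finset.range (T + 1), (T.choose k : ℝ) * (-1) ^ (k + 1) * poch b (k + 1)
          / (descProd c (k + 1) * descProd (z - k) (T + 1)) := by
      rw [Finset.sum_range_succ']
      simp only [Nat.cast_zero, mul_zero, zero_div, zero_mul, add_zero]
      refine Finset.sum_congr rfl fun k hk => ?_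
      have h := Nat.add_one_mul_choose_eq T k
      have h' : ((T : ℝ) + 1) * (T.choose k : ℝ) = ((T + 1).choose (k + 1) : ℝ) * (k + 1) := by
        exact_mod_cast h
      push_cast
      rw [← h', show z - ((k : ℝ) + 1) + 1 = z - k by ring]
      have h5 : (T : ℝ) + 1 ≠ 0 := by positivity
      field_simp
    rw [e1, e2, ← Finset.sum_add_distrib, Finset.sum_congr rfl key, ← Finset.mul_sum,
      ih (z - 1) (c - 1) (by rw [hc]; ring) (by linarith) (by linarith), descProd_succ']
    rw [div_mul_div_comm, one_mul]

/-! ### Hahn eigenvectors and their discrete orthogonality -/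

/-- The function `j ↦ 1 / (M - j)!`, extended by zero to `j > M`. -/
def invFact (M j : ℕ) : ℝ := if j ≤ M then 1 / ((M - j).factorial : ℝ) else 0

theorem invFact_succ_succ (M j : ℕ) : invFact (M + 1) (j + 1) = invFact M j := by
  simp [invFact]

theorem invFact_of_lt {M j : ℕ} (h : M < j) : invFact M j = 0 := by
  simp [invFact, h]

theorem invFact_self (M : ℕ) : invFact M M = 1 := by simp [invFact]

theorem invFact_mul (M j : ℕ) : invFact (M + 1) j * ((M : ℝ) + 1 - j) = invFact M j := by
  rcases lt_trichotomy j (M + 1) with h | h | h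
  · obtain ⟨e, rfl⟩ := Nat.exists_eq_add_of_le (Nat.lt_succ_iff.1 h)
    have h1 : j + e + 1 - j = e + 1 := by omega
    have h2 : j + e - j = e := by omega
    rw [invFact, invFact, if_pos (by omega), if_pos (by omega), h1, h2, Nat.factorial_succ]
    push_cast
    have := Nat.factorial_ne_zero e
    field_simp
    ring
  · subst h
    rw [invFact_of_lt (Nat.lt_succ_self M)]; push_cast; ring
  · rw [invFact_of_lt h, invFact_of_lt (by omega)]; ring

/-- The tridiagonal operator of which the Hahn polynomials are eigenfunctions. -/
def hahnOp (N : ℕ) (q s : ℝ) (f : ℕ → ℝ) (j : ℕ) : ℝ :=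
  (s - j + 1) * j * (N - j) * f (j - 1) + (j + 1 + q) * f (j + 1)
    - ((s - j + 1) * j + (N - 1 - j) * (j + 1 + q)) * f j

/-- In the basis `invFact M` the operator is bidiagonal, so the eigenvalue equation becomes a
first-order recurrence for the expansion coefficients. -/
theorem hahnOp_invFact (N : ℕ) (q s : ℝ) (M j : ℕ) :
    hahnOp N q s (invFact M) j = -((N - 1 - M) * (s - M + 1 + q)) * invFact M j
      + (N - 1 - M) * (s - M) * (M + 1) * invFact (M + 1) j := by
  have h1 : invFact M (j + 1) = invFact M j * (M - j) := by
    rw [← invFact_succ_succ M j, ← invFact_mul M (j + 1)]; push_cast; ring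
  rw [hahnOp, h1, ← invFact_mul M j]
  -- At `j = 0` the truncated index `j - 1` is harmless, as its coefficient contains the factor `j`.
  rcases j with _ | j
  · simp; ring
  · rw [Nat.add_sub_cancel, invFact_succ_succ]
    push_cast
    ring

/-- Summation by parts: the condition on `ω` is detailed balance for the off-diagonal coefficients,
so only the Casoratian at the upper end survives. -/
theorem hahnOp_symm (N s : ℕ) (q : ℝ) (ω f g : ℕ → ℝ)
    (hω : ∀ j, j + 1 < N → j + 1 ≤ s →
      ω (j + 1) * ((s - j) * (j + 1) * (N - 1 - j)) = ω j * (j + 1 + q))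
    (m : ℕ) (hm : m < N) (hs : m ≤ s) :
    ∑ j ∈ Finset.range (m + 1), ω j * (hahnOp N q s f j * g j - f j * hahnOp N q s g j)
      = ω m * (m + 1 + q) * (f (m + 1) * g m - f m * g (m + 1)) := by
  induction m with
  | zero => simp [hahnOp]; ring
  | succ m ih =>
    rw [Finset.sum_range_succ, ih (by omega) (by omega), ← hω m hm hs]
    simp only [hahnOp, Nat.add_sub_cancel]
    push_cast
    ring

/-- The expansion coefficients of the monic Hahn polynomials. -/
def hahnCoeff (N : ℕ) (q : ℝ) (n i t : ℕ) : ℝ :=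
  (-1) ^ t * ((N - 1 - i).choose t : ℝ) * poch (i + 1) t * (n.descFactorial t : ℝ)
    / descProd (n + N - i + q) t

theorem hahnCoeff_zero (N : ℕ) (q : ℝ) (n i : ℕ) : hahnCoeff N q n i 0 = 1 := by
  simp [hahnCoeff, poch_zero, descProd_zero]

theorem hahnCoeff_eq_zero {N : ℕ} {q : ℝ} {n i t : ℕ} (h : N - 1 - i < t ∨ n < t) :
    hahnCoeff N q n i t = 0 := by
  rcases h with h | h
  · simp [hahnCoeff, Nat.choose_eq_zero_of_lt h]
  · simp [hahnCoeff, Nat.descFactorial_eq_zero_iff_lt.2 h]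

theorem hahnCoeff_ne_zero {N : ℕ} {q : ℝ} (hq : 0 < q) {n i t : ℕ} (hi : i < N)
    (h : t ≤ N - 1 - i) (hn : t ≤ n) : hahnCoeff N q n i t ≠ 0 := by
  rw [hahnCoeff]
  have h1 : ((N - 1 - i).choose t : ℝ) ≠ 0 := by exact_mod_cast (Nat.choose_pos h).ne'
  have h2 : (n.descFactorial t : ℝ) ≠ 0 := by
    rw [Nat.cast_ne_zero, Ne, Nat.descFactorial_eq_zero_iff_lt]; omega
  have h3 : poch ((i : ℝ) + 1) t ≠ 0 := (poch_pos (by positivity) t).ne'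
  have h4 : descProd (n + N - i + q) t ≠ 0 := by
    refine (descProd_pos ?_).ne'
    have : (t : ℝ) ≤ n := by exact_mod_cast hn
    have : (i : ℝ) < N := by exact_mod_cast hi
    linarith
  have h5 : ((-1) ^ t : ℝ) ≠ 0 := by simp
  positivity

theorem hahnCoeff_succ {N : ℕ} {q : ℝ} (hq : 0 < q) {i : ℕ} (hi : i < N) (n t : ℕ) :
    hahnCoeff N q n i (t + 1) * ((t + 1) * (n + N - 1 - i + q - t))
      = -((N - 1 - i - t) * (n - t) * (i + 1 + t)) * hahnCoeff N q n i t := by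
  by_cases h : N - 1 - i < t ∨ n < t
  · rw [hahnCoeff_eq_zero h, hahnCoeff_eq_zero (by omega)]; ring
  push Not at h
  have hn : (t : ℝ) ≤ n := by exact_mod_cast h.2
  have hi' : (i : ℝ) + 1 ≤ N := by exact_mod_cast hi
  have h1 : descProd (n + N - i + q) t ≠ 0 := (descProd_pos (by linarith)).ne'
  have h2 : ((n : ℝ) + N - i + q - (t + 1)) ≠ 0 := by
    have : 0 < (n : ℝ) + N - i + q - (t + 1) := by linarith
    exact this.ne'
  have h3 : ((N - 1 - i).choose (t + 1) : ℝ) * (t + 1)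
      = ((N - 1 - i).choose t : ℝ) * (N - 1 - i - t) := by
    have e : ((N - 1 - i - t : ℕ) : ℝ) = N - 1 - i - t := by
      rw [Nat.cast_sub h.1, Nat.cast_sub (by omega), Nat.cast_sub (by omega)]; simp
    rw [← e]
    exact_mod_cast Nat.choose_succ_right_eq (N - 1 - i) t
  have h4 : (n.descFactorial (t + 1) : ℝ) = (n - t) * n.descFactorial t := by
    rw [Nat.descFactorial_succ, Nat.cast_mul, Nat.cast_sub h.2]
  rw [hahnCoeff, hahnCoeff, descProd_succ, poch_succ, h4, pow_succ]
  rw [show (n : ℝ) + N - 1 - i + q - t = n + N - i + q - (t + 1) by ring]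
  generalize ((N - 1 - i).choose (t + 1) : ℝ) = a at *
  generalize ((N - 1 - i).choose t : ℝ) = b at *
  generalize descProd (n + N - i + q) t = D at *
  generalize ((n : ℝ) + N - i + q - (t + 1)) = x at *
  generalize poch ((i : ℝ) + 1) t = p
  generalize (n.descFactorial t : ℝ) = e at *
  generalize ((-1 : ℝ)) ^ t = ε
  rw [div_mul_eq_mul_div, ← mul_div_assoc, div_eq_div_iff (mul_ne_zero h1 h2) h1]
  linear_combination (-ε * p * e * (i + 1 + t) * (n - t) * x * D) * h3

/-- The eigenfunctions of `hahnOp`. -/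
def hahnVec (N : ℕ) (q : ℝ) (n i j : ℕ) : ℝ :=
  ∑ t ∈ Finset.range (n + 1), hahnCoeff N q n i t * invFact (i + t) j

theorem hahnVec_eq_zero {N : ℕ} {q : ℝ} {n i j : ℕ} (hi : i < N) (h : N ≤ j ∨ n + i < j) :
    hahnVec N q n i j = 0 := by
  refine Finset.sum_eq_zero fun t ht => ?_
  have ht := Finset.mem_range.1 ht
  rcases lt_or_ge (i + t) j with h' | h'
  · rw [invFact_of_lt h', mul_zero]
  · rw [hahnCoeff_eq_zero (by omega), zero_mul]

/-- At the last index of the support only the term `t = j - i` survives. This later makes the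
diagonal of `⟨P_n, P_n⟩` nonzero. -/
theorem hahnVec_ne_zero {N : ℕ} {q : ℝ} (hq : 0 < q) {n i : ℕ} (hi : i < N) :
    hahnVec N q n i (min (i + n) (N - 1)) ≠ 0 := by
  set j := min (i + n) (N - 1) with hj
  have hji : i ≤ j := by omega
  rw [hahnVec, Finset.sum_eq_single (j - i)]
  · rw [show i + (j - i) = j by omega, invFact_self, mul_one]
    exact hahnCoeff_ne_zero hq hi (by omega) (by omega)
  · intro t ht hne
    have ht := Finset.mem_range.1 ht
    rcases lt_or_ge (i + t) j with h' | h'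
    · rw [invFact_of_lt h', mul_zero]
    · rw [hahnCoeff_eq_zero (by omega), zero_mul]
  · intro h
    exact absurd (Finset.mem_range.2 (by omega)) h

theorem hahnOp_hahnVec {N : ℕ} {q : ℝ} (hq : 0 < q) {i : ℕ} (hi : i < N) (n j : ℕ) :
    hahnOp N q (n + i) (hahnVec N q n i) j
      = -((N - 1 - i) * (n + 1 + q)) * hahnVec N q n i j := by
  have lin : hahnOp N q (n + i) (hahnVec N q n i) j
      = ∑ t ∈ Finset.range (n + 1),
        hahnCoeff N q n i t * hahnOp N q (n + i) (invFact (i + t)) j := by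
    simp only [hahnOp, hahnVec, Finset.mul_sum, ← Finset.sum_add_distrib,
      ← Finset.sum_sub_distrib]
    refine Finset.sum_congr rfl fun t _ => ?_
    ring
  rw [lin, ← sub_eq_zero, hahnVec, Finset.mul_sum, ← Finset.sum_sub_distrib]
  -- By the recurrence `hahnCoeff_succ` the partial sums telescope to one boundary term, which
  -- vanishes at `m = n + 1`.
  have tele : ∀ m : ℕ, ∑ t ∈ Finset.range m,
      (hahnCoeff N q n i t * hahnOp N q (n + i) (invFact (i + t)) j
        - -((N - 1 - i) * (n + 1 + q)) * (hahnCoeff N q n i t * invFact (i + t) j))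
      = -(hahnCoeff N q n i m * (m * (n + N - i + q - m))) * invFact (i + m) j := by
    intro m
    induction m with
    | zero => simp
    | succ m ih =>
      rw [Finset.sum_range_succ, ih, hahnOp_invFact]
      have h := hahnCoeff_succ hq hi n m
      push_cast
      rw [← add_assoc]
      linear_combination (invFact (i + m + 1) j) * h
  rw [tele, hahnCoeff_eq_zero (Or.inr (Nat.lt_succ_self n))]
  ring

theorem hahnVec_orthogonal {N : ℕ} {q : ℝ} (hq : 0 < q) {n m i k : ℕ} (hi : i < N) (hk : k < N)
    (hs : n + i = m + k) (hne : n ≠ m) (ω : ℕ → ℝ)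
    (hω : ∀ j, j + 1 < N → j + 1 ≤ n + i →
      ω (j + 1) * (((n : ℝ) + i - j) * (j + 1) * (N - 1 - j)) = ω j * (j + 1 + q)) :
    ∑ j ∈ Finset.range (min N (n + i + 1)), ω j * (hahnVec N q n i j * hahnVec N q m k j) = 0 := by
  -- Both vectors vanish at `K + 1`, either by reaching `N` or by passing `n + i = m + k`, so the
  -- boundary term of `hahnOp_symm` drops out.
  obtain ⟨K, hK⟩ : ∃ K, min N (n + i + 1) = K + 1 := ⟨min N (n + i + 1) - 1, by omega⟩
  have hsR : (n : ℝ) + i = m + k := by exact_mod_cast hs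
  have h := hahnOp_symm N (n + i) q ω (hahnVec N q n i) (hahnVec N q m k)
    (by push_cast; exact hω) K (by omega) (by omega)
  rw [hahnVec_eq_zero (j := K + 1) hi (by omega), hahnVec_eq_zero (j := K + 1) hk (by omega)] at h
  rw [hK]
  have e : ∀ j, ω j * (hahnOp N q ((n + i : ℕ) : ℝ) (hahnVec N q n i) j * hahnVec N q m k j
      - hahnVec N q n i j * hahnOp N q ((n + i : ℕ) : ℝ) (hahnVec N q m k) j)
      = ((N - 1 - k) * (m + 1 + q) - (N - 1 - i) * (n + 1 + q))
        * (ω j * (hahnVec N q n i j * hahnVec N q m k j)) := by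
    intro j
    rw [show ((n + i : ℕ) : ℝ) = n + i by push_cast; ring, hahnOp_hahnVec hq hi, hsR,
      hahnOp_hahnVec hq hk]
    ring
  simp only [e, ← Finset.mul_sum] at h
  rw [zero_mul, mul_zero, sub_zero, mul_zero] at h
  refine (mul_eq_zero.1 h).resolve_left ?_
  have hn : (n : ℝ) = m + k - i := by linarith
  -- The difference of the eigenvalues factors, with one positive factor; the other, `i - k`, is
  -- nonzero since `n ≠ m` on the line `n + i = m + k`.
  have e2 : ((N : ℝ) - 1 - k) * (m + 1 + q) - (N - 1 - i) * (n + 1 + q)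
      = (i - k) * ((N - 1 - i) + m + 1 + q) := by rw [hn]; ring
  rw [e2]
  have hi' : (i : ℝ) + 1 ≤ N := by exact_mod_cast hi
  have hm : (0 : ℝ) ≤ m := Nat.cast_nonneg m
  refine mul_ne_zero ?_ ?_
  · rw [sub_ne_zero]
    exact_mod_cast (by omega : i ≠ k)
  · have : 0 < (N - 1 - i : ℝ) + m + 1 + q := by linarith
    exact this.ne'

/-! ### Simplification of the connection coefficients and their summation -/

/-- The connection coefficient in simplified form, without the factor depending on `α`. -/
def connRed (N : ℕ) (q l : ℝ) (n k i : ℕ) : ℝ :=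
  ((2 : ℝ) ^ k)⁻¹ * ((N - 1 - i).choose k : ℝ) * poch (i + 1) k * (n.descFactorial k : ℝ)
    * poch (q - l) k / (descProd (n + N - i + q) k * descProd (n + N - i + l - k + 1) k)

theorem prod_shift_eq_poch_div {q : ℝ → ℝ} {ν a b : ℝ}
    (hpos : ∀ p : ℕ, 0 < q (ν + p)) (ha : 0 < a)
    (h : (∀ p : ℕ, q (ν + p) = q ν + p) ∨ a = b) (n : ℕ) :
    ∏ p ∈ Finset.range n, (a + q (ν + p)) / (b + q (ν + p))
      = poch (a + q ν) n / poch (b + q ν) n := by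
  rcases h with h | h
  · rw [poch_eq_prod, poch_eq_prod, ← Finset.prod_div_distrib]
    refine Finset.prod_congr rfl fun p _ => ?_
    rw [h]; ring
  · subst h
    have h0 : 0 < q ν := by simpa using hpos 0
    rw [div_self (poch_pos (by positivity) n).ne']
    refine Finset.prod_eq_one fun p _ => div_self ?_
    have := hpos p
    positivity

/-- With `q_{μ+p} = q_μ + p` the products are quotients of rising factorials. Those in `q ν` and
those in `q lam` each cancel down to one descending product of length `k`. -/
theorem connCoeff_eq {N : ℕ} (α : ℕ → ℝ) {q : ℝ → ℝ} {ν lam : ℝ}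
    (hν : ∀ p : ℕ, 0 < q (ν + p)) (hlam : ∀ p : ℕ, 0 < q (lam + p))
    (hν' : 2 ≤ N → ∀ p : ℕ, q (ν + p) = q ν + p)
    (hlam' : 2 ≤ N → ∀ p : ℕ, q (lam + p) = q lam + p)
    {n k i : ℕ} (hk : k ≤ n) (hi : i + k < N) :
    connCoeff N α q ν lam n k (i + 1)
      = α (i + 1) / α (i + 1 + k) * connRed N (q ν) (q lam) n k i := by
  obtain ⟨a, rfl⟩ : ∃ a, N = i + 1 + (a + k) := ⟨N - (i + 1) - k, by omega⟩
  obtain ⟨b, rfl⟩ : ∃ b, n = b + k := ⟨n - k, by omega⟩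
  have hq : 0 < q ν := by simpa using hν 0
  have hl : 0 < q lam := by simpa using hlam 0
  have hN1 : i + 1 + (a + k) - (i + 1) = a + k := by omega
  have hN2 : i + 1 + (a + k) - 1 - i = a + k := by omega
  have hN3 : a + k - k = a := by omega
  have hN4 : b + k - k = b := by omega
  -- If `a + k = 0` the numerator and denominator of every factor agree and no shift rule is needed;
  -- otherwise `N ≥ 2`, and the shift rule is available.
  have p1 := prod_shift_eq_poch_div (q := q) (ν := ν) (a := 1) (b := (a : ℝ) + k + 1) hν one_pos
    (by
      rcases Nat.eq_zero_or_pos (a + k) with h | h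
      · have h1 : a = 0 := by omega
        have h2 : k = 0 := by omega
        right; simp [h1, h2]
      · exact Or.inl (hν' (by omega))) (b + k)
  have p2 := prod_shift_eq_poch_div (q := q) (ν := lam) (a := (a : ℝ) + 1) (b := 1) hlam
    (by positivity)
    (by
      rcases Nat.eq_zero_or_pos (a + k) with h | h
      · have h1 : a = 0 := by omega
        right; simp [h1]
      · exact Or.inl (hlam' (by omega))) b
  rw [connCoeff, connRed, hN1, hN2, hN3, hN4, poch_neg_nat]
  push_cast
  simp only [show (i : ℝ) + 1 + (a + k) - (i + 1) + 1 = a + k + 1 by ring,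
    show (i : ℝ) + 1 + (a + k) - (i + 1) - k + 1 = a + 1 by ring]
  rw [p1, p2]
  generalize q ν = x at *
  generalize q lam = y at *
  have ha0 : (0 : ℝ) ≤ a := Nat.cast_nonneg a
  have hb0 : (0 : ℝ) ≤ b := Nat.cast_nonneg b
  have hk0 : (0 : ℝ) ≤ k := Nat.cast_nonneg k
  have e1 : poch (1 + x) (b + k) * poch (b + k + 1 + x) a = poch (1 + x) (b + k + a) := by
    rw [poch_add (1 + x) (b + k) a]; push_cast; ring_nf
  have e2 : poch (x + 1) (a + k) * poch (a + k + 1 + x) (b + k)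
      = poch (1 + x) (b + k + a) * descProd (b + k + (a + k) + 1 + x) k := by
    have h1 := poch_add (1 + x) (a + k) (b + k)
    have h2 := poch_add (1 + x) (b + k + a) k
    rw [show a + k + (b + k) = b + k + a + k by ring, h2, poch_eq_descProd _ k] at h1
    push_cast at h1
    rw [show x + 1 = 1 + x by ring, show (a : ℝ) + k + 1 + x = 1 + x + (a + k) by ring, ← h1]
    congr 2; ring
  have e3 : poch (y + 1) a * poch (a + 1 + y) b = poch (1 + y) (a + b) := by
    rw [poch_add (1 + y) a b]; ring_nf
  have e4 : poch (1 + y) b * poch (b + 1 + y) (a + k)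
      = poch (1 + y) (a + b) * poch (a + b + 1 + y) k := by
    have h1 := poch_add (1 + y) b (a + k)
    have h2 := poch_add (1 + y) (a + b) k
    rw [show b + (a + k) = a + b + k by ring, h2] at h1
    push_cast at h1
    rw [show (b : ℝ) + 1 + y = 1 + y + b by ring, ← h1]
    congr 2; ring
  have e5 : poch (a + b + 1 + y) k * (a + b + k + 1 + y)
      = (a + b + 1 + y) * descProd (a + b + k + 2 + y) k := by
    have h1 := poch_add (a + b + 1 + y) 1 k
    rw [add_comm 1 k, poch_succ, poch_eq_descProd _ k, poch_succ, poch_zero] at h1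
    rw [show (a : ℝ) + b + k + 1 + y = a + b + 1 + y + k by ring, poch_eq_descProd _ k, h1]
    rw [poch_eq_descProd (_ + _) k]
    push_cast
    ring_nf
  have d1 : 0 < poch (1 + x) (b + k + a) := poch_pos (by positivity) _
  have d2 : 0 < poch (x + 1) (a + k) := poch_pos (by positivity) _
  have d3 : 0 < poch (a + k + 1 + x) (b + k) := poch_pos (by positivity) _
  have d4 : 0 < poch (1 + y) b := poch_pos (by positivity) _
  have d5 : 0 < poch (b + 1 + y) (a + k) := poch_pos (by positivity) _
  have d6 : 0 < poch (1 + y) (a + b) := poch_pos (by positivity) _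
  have d7 : 0 < (a : ℝ) + b + k + 1 + y := by positivity
  have d8 : 0 < descProd (b + k + (a + k) + 1 + x) k := descProd_pos (by linarith)
  have d9 : 0 < descProd (a + b + k + 2 + y) k := descProd_pos (by linarith)
  have r1 : poch (1 + x) (b + k) / poch (a + k + 1 + x) (b + k) *
      (poch (b + k + 1 + x) a / poch (x + 1) (a + k))
      = 1 / descProd (b + k + (a + k) + 1 + x) k := by
    rw [div_mul_div_comm, e1, mul_comm (poch (a + k + 1 + x) (b + k)), e2]
    field_simp
  have r2 : poch (a + 1 + y) b / poch (1 + y) b * (poch (y + 1) a / poch (b + 1 + y) (a + k))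
      * ((a + b + 1 + y) / (a + b + k + 1 + y)) = 1 / descProd (a + b + k + 2 + y) k := by
    rw [div_mul_div_comm, mul_comm (poch (a + 1 + y) b), e3, e4, div_mul_div_comm,
      mul_assoc (poch (1 + y) (a + b)), e5]
    have : (a : ℝ) + b + 1 + y ≠ 0 := by positivity
    field_simp
  rw [show (b : ℝ) + k - k + 1 + y = b + 1 + y by ring,
    show (i : ℝ) + 1 + (a + k) - (i + 1) - 2 * k + (b + k) + 1 + y = a + b + 1 + y by ring,
    show (i : ℝ) + 1 + (a + k) - (i + 1) - k + (b + k) + 1 + y = a + b + k + 1 + y by ring,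
    show (b : ℝ) + k + (i + 1 + (a + k)) - i + x = b + k + (a + k) + 1 + x by ring,
    show (b : ℝ) + k + (i + 1 + (a + k)) - i + y - k + 1 = a + b + k + 2 + y by ring]
  rw [show ∀ A B : ℝ, ∀ C D : ℝ, A * B / (C * D) = A * B * (1 / C) * (1 / D) by
    intros; field_simp, ← r1, ← r2]
  ring

theorem mul_div_regroup {p b1 b2 b3 b4 g1 g2 g3 f1 f2 s1 s2 d1 d2 d3 d4 : ℝ} (hp : p ≠ 0)
    (h1 : d1 ≠ 0) (h2 : d2 ≠ 0) (h3 : d3 ≠ 0) (h4 : d4 ≠ 0) (hs : s1 * s1 = 1)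
    (hb : b1 * b2 = b3 * b4) :
    p * (p⁻¹ * b1 * g2 * f2 * g1 / (d3 * d1)) * (s2 * b2 * g3 * f1 / d2)
      = s1 * s2 * b3 * (g2 * g3) * (f2 * f1) * (b4 * s1 * g1 * d4 / (d3 * (d1 * d4 * d2))) := by
  have L : p * (p⁻¹ * b1 * g2 * f2 * g1 / (d3 * d1)) * (s2 * b2 * g3 * f1 / d2)
      = (b1 * b2) * (g2 * f2 * g1 * s2 * g3 * f1) / (d3 * d1 * d2) := by
    field_simp
  have R : b4 * s1 * g1 * d4 / (d3 * (d1 * d4 * d2)) = b4 * s1 * g1 / (d3 * d1 * d2) := by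
    field_simp
  rw [L, R, hb]
  linear_combination (-(b3 * b4 * (g2 * f2 * g1 * s2 * g3 * f1) / (d3 * d1 * d2))) * hs

/-- This is the scalar content of the connection formula. The summands match those of
`sum_wellPoised` with `b = q - l`, `z = n + N - i + l`, `c = n + N - i + q`, up to a factor
independent of `k`. -/
theorem sum_connRed_mul_hahnCoeff {N : ℕ} {q l : ℝ} (hq : 0 < q) (hl : 0 < l) {n i T : ℕ}
    (hi : i + T < N) (hT : T ≤ n) :
    ∑ k ∈ Finset.range (T + 1),
      2 ^ k * connRed N q l n k i * hahnCoeff N l (n - k) (i + k) (T - k)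
      = hahnCoeff N q n i T := by
  have hTR : (T : ℝ) ≤ n := by exact_mod_cast hT
  have hiR : (i : ℝ) + T + 1 ≤ N := by exact_mod_cast hi
  have hT0 : (0 : ℝ) ≤ T := Nat.cast_nonneg T
  have main := sum_wellPoised (q - l) T (n + N - i + l) (n + N - i + q) (by ring)
    (by linarith) (by linarith)
  rw [hahnCoeff, div_eq_mul_one_div, ← main, Finset.mul_sum]
  refine Finset.sum_congr rfl fun k hk => ?_
  have hk : k ≤ T := Nat.lt_succ_iff.1 (Finset.mem_range.1 hk)
  obtain ⟨e, rfl⟩ := Nat.exists_eq_add_of_le hk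
  push_cast at hTR hiR hT0
  have he0 : (0 : ℝ) ≤ e := Nat.cast_nonneg e
  have hk0 : (0 : ℝ) ≤ k := Nat.cast_nonneg k
  have c1 : ((N - 1 - i).choose k : ℝ) * ((N - 1 - (i + k)).choose e : ℝ)
      = ((N - 1 - i).choose (k + e) : ℝ) * ((k + e).choose k : ℝ) := by
    have h := Nat.choose_mul (n := N - 1 - i) (k := k + e) (s := k) (by omega)
    rw [Nat.add_sub_cancel_left, Nat.sub_sub (N - 1) i k] at h
    exact_mod_cast h.symm
  have c2 : (n.descFactorial k : ℝ) * ((n - k).descFactorial e : ℝ)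
      = (n.descFactorial (k + e) : ℝ) := by
    have h := Nat.descFactorial_mul_descFactorial (n := n) (k := k) (m := k + e) (by omega)
    rw [Nat.add_sub_cancel_left] at h
    rw [← h]; push_cast; ring
  have c3 := poch_add (i + 1) k e
  -- The middle factor of the long product is `z - 2k`, which cancels the very-well-poised
  -- numerator; the two outer pieces are the denominators from `connRed` and `hahnCoeff`.
  have c4 : descProd (n + N - i + l - k + 1) (k + e + 1)
      = descProd (n + N - i + l - k + 1) k * ((n + N - i + l) - 2 * k)
        * descProd (n + N - i + l - 2 * k) e := by
    rw [add_right_comm, descProd_add _ (k + 1) e, descProd_succ]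
    push_cast
    ring_nf
  have s0 : (-1 : ℝ) ^ k * (-1) ^ k = 1 := by rw [← mul_pow]; simp
  have h1 : descProd (n + N - i + l - k + 1) k ≠ 0 := (descProd_pos (by linarith)).ne'
  have h2 : descProd (n + N - i + l - 2 * k) e ≠ 0 := (descProd_pos (by linarith)).ne'
  have h3 : descProd (n + N - i + q) k ≠ 0 := (descProd_pos (by linarith)).ne'
  have h4 : (n : ℝ) + N - i + l - 2 * k ≠ 0 := by
    have : 0 < (n : ℝ) + N - i + l - 2 * k := by linarith
    exact this.ne'
  have hnk : ((n - k : ℕ) : ℝ) = n - k := Nat.cast_sub (by omega)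
  rw [connRed, hahnCoeff, Nat.add_sub_cancel_left, c4, ← c2, c3, hnk]
  rw [show (i : ℝ) + 1 + (k : ℝ) = ((i + k : ℕ) : ℝ) + 1 by push_cast; ring,
    show ((n : ℝ) - k + N - ((i + k : ℕ) : ℝ) + l) = n + N - i + l - 2 * k by push_cast; ring,
    pow_add]
  generalize descProd ((n : ℝ) + N - i + l - k + 1) k = d1 at *
  generalize descProd ((n : ℝ) + N - i + l - 2 * k) e = d2 at *
  generalize descProd ((n : ℝ) + N - i + q) k = d3 at *
  generalize (n : ℝ) + N - i + l - 2 * k = d4 at *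
  generalize ((n - k).descFactorial e : ℝ) = f1 at *
  generalize (n.descFactorial k : ℝ) = f2 at *
  generalize ((N - 1 - i).choose k : ℝ) = b1 at *
  generalize ((N - 1 - (i + k)).choose e : ℝ) = b2 at *
  generalize ((N - 1 - i).choose (k + e) : ℝ) = b3 at *
  generalize ((k + e).choose k : ℝ) = b4 at *
  generalize poch (q - l) k = g1
  generalize poch ((i : ℝ) + 1) k = g2
  generalize poch (((i + k : ℕ) : ℝ) + 1) e = g3
  generalize (-1 : ℝ) ^ k = s1 at *
  generalize (-1 : ℝ) ^ e = s2 at *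
  exact mul_div_regroup (by positivity) h1 h2 h3 h4 s0 c1

/-! ### Scalar Hermite polynomials and Gaussian integrals -/

theorem derivative_hermiteH_succ (n : ℕ) :
    derivative (hermiteH (n + 1)) = C (2 * ((n : ℝ) + 1)) * hermiteH n := by
  induction n with
  | zero => simp [hermiteH, ← C_ofNat]
  | succ n ih =>
    have h : hermiteH (n + 2) = 2 * X * hermiteH (n + 1) - derivative (hermiteH (n + 1)) := rfl
    have h' : hermiteH (n + 1) = 2 * X * hermiteH n - derivative (hermiteH n) := rfl
    rw [h, derivative_sub, ih, derivative_mul, ih, derivative_C_mul]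
    simp only [derivative_mul, derivative_X, derivative_ofNat, h', map_mul, map_add, map_one,
      C_ofNat, Nat.cast_add, Nat.cast_one]
    ring

theorem hermiteH_add_two (n : ℕ) :
    hermiteH (n + 2) = 2 * X * hermiteH (n + 1) - C (2 * ((n : ℝ) + 1)) * hermiteH n := by
  rw [← derivative_hermiteH_succ]; rfl

theorem integrable_gaussian_mul_pow (n : ℕ) :
    MeasureTheory.Integrable fun x : ℝ => Real.exp (-x ^ 2) * x ^ n := by
  have h := integrable_rpow_mul_exp_neg_mul_sq (b := 1) one_pos (s := (n : ℝ))
    (by have : (0 : ℝ) ≤ n := Nat.cast_nonneg n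
        linarith)
  refine h.congr (Filter.Eventually.of_forall fun x => ?_)
  simp only [Real.rpow_natCast]
  rw [mul_comm, neg_one_mul]

theorem integrable_gaussian_mul_eval (p : ℂ[X]) :
    MeasureTheory.Integrable fun x : ℝ => (Real.exp (-x ^ 2) : ℂ) * p.eval (x : ℂ) := by
  induction p using Polynomial.induction_on' with
  | add p q hp hq =>
    simp only [eval_add, mul_add]
    exact hp.add hq
  | monomial n a =>
    refine (((integrable_gaussian_mul_pow n).ofReal (𝕜 := ℂ)).const_mul a).congr
      (Filter.Eventually.of_forall fun x => ?_)
    simp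
    ring

theorem integrable_gaussian_mul_eval_real (p : ℝ[X]) :
    MeasureTheory.Integrable fun x : ℝ => Real.exp (-x ^ 2) * p.eval x := by
  induction p using Polynomial.induction_on' with
  | add p q hp hq =>
    simp only [eval_add, mul_add]
    exact hp.add hq
  | monomial n a =>
    refine ((integrable_gaussian_mul_pow n).const_mul a).congr
      (Filter.Eventually.of_forall fun x => ?_)
    simp
    ring

/-- Integration of polynomials against the Gaussian weight `exp (-x²)`. -/
def gaussInt (p : ℝ[X]) : ℝ := ∫ x : ℝ, Real.exp (-x ^ 2) * p.eval x

theorem gaussInt_sub (p q : ℝ[X]) : gaussInt (p - q) = gaussInt p - gaussInt q := by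
  rw [gaussInt, gaussInt, gaussInt, ← MeasureTheory.integral_sub
    (integrable_gaussian_mul_eval_real p) (integrable_gaussian_mul_eval_real q)]
  simp only [eval_sub, mul_sub]

theorem gaussInt_C_mul (a : ℝ) (p : ℝ[X]) : gaussInt (C a * p) = a * gaussInt p := by
  rw [gaussInt, gaussInt, ← MeasureTheory.integral_const_mul]
  simp only [eval_mul, eval_C]
  congr 1
  ext x
  ring

theorem gaussInt_derivative (p : ℝ[X]) : gaussInt (2 * X * p) = gaussInt (derivative p) := by
  have h : gaussInt (derivative p - 2 * X * p) = 0 := by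
    refine MeasureTheory.integral_eq_zero_of_hasDerivAt_of_integrable
      (f := fun x => Real.exp (-x ^ 2) * p.eval x) (fun x => ?_)
      (integrable_gaussian_mul_eval_real _) (integrable_gaussian_mul_eval_real _)
    have h1 : HasDerivAt (fun x : ℝ => Real.exp (-x ^ 2)) (Real.exp (-x ^ 2) * (-(2 * x))) x := by
      have := ((hasDerivAt_pow 2 x).neg).exp
      simpa using this
    convert! h1.mul (p.hasDerivAt x) using 1
    simp
    ring
  rw [gaussInt_sub] at h
  linarith

/-- The raising operator `2x - d/dx` is adjoint to `d/dx` for the Gaussian weight; orthogonality and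
norms follow by lowering both indices. -/
theorem gaussInt_hermiteH_succ_mul (m : ℕ) (g : ℝ[X]) :
    gaussInt (hermiteH (m + 1) * g) = gaussInt (hermiteH m * derivative g) := by
  have h : hermiteH (m + 1) * g = 2 * X * (hermiteH m * g) - derivative (hermiteH m) * g := by
    rw [hermiteH]; ring
  rw [h, gaussInt_sub, gaussInt_derivative, derivative_mul, ← gaussInt_sub]
  congr 1
  ring

/-- The squared norm of the Hermite polynomial `H_n`. -/
def hermiteNorm (n : ℕ) : ℝ := gaussInt (hermiteH n * hermiteH n)

theorem hermiteNorm_succ (n : ℕ) : hermiteNorm (n + 1) = 2 * (n + 1) * hermiteNorm n := by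
  rw [hermiteNorm, gaussInt_hermiteH_succ_mul, derivative_hermiteH_succ, mul_left_comm,
    gaussInt_C_mul]
  rfl

theorem hermiteNorm_pos (n : ℕ) : 0 < hermiteNorm n := by
  induction n with
  | zero =>
    have h := integral_gaussian 1
    simp only [neg_one_mul, div_one] at h
    simp only [hermiteNorm, gaussInt, hermiteH, mul_one, eval_one]
    rw [h]
    exact Real.sqrt_pos.2 Real.pi_pos
  | succ n ih => rw [hermiteNorm_succ]; positivity

theorem gaussInt_hermiteH_mul_of_lt {m n : ℕ} (h : n < m) :
    gaussInt (hermiteH m * hermiteH n) = 0 := by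
  induction m generalizing n with
  | zero => omega
  | succ m ih =>
    rw [gaussInt_hermiteH_succ_mul]
    rcases n with _ | n
    · simp [hermiteH, gaussInt]
    · rw [derivative_hermiteH_succ, mul_left_comm, gaussInt_C_mul, ih (by omega), mul_zero]

theorem gaussInt_hermiteH_mul (m n : ℕ) :
    gaussInt (hermiteH m * hermiteH n) = if m = n then hermiteNorm m else 0 := by
  rcases lt_trichotomy m n with h | h | h
  · rw [mul_comm, gaussInt_hermiteH_mul_of_lt h, if_neg h.ne]
  · subst h; simp [hermiteNorm]
  · rw [gaussInt_hermiteH_mul_of_lt h, if_neg h.ne']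

/-! ### Matrix valued Hermite polynomials -/

variable {N : ℕ} {α : ℕ → ℝ}

/-- The matrix with entries `α_i / α_j * H_{m+i-j}(x) / (i-j)!`. -/
def shiftedL (N : ℕ) (α : ℕ → ℝ) (m : ℕ) (x : ℝ) : Matrix (Fin N) (Fin N) ℂ :=
  Matrix.of fun i j =>
    ((α (i + 1) / α (j + 1) * (invFact i j * (hermiteH (m + i - j)).eval x) : ℝ) : ℂ)

theorem Lα_eq_shiftedL (hα : ∀ k, 1 ≤ k → k ≤ N → α k ≠ 0) (x : ℝ) :
    Lα N α x = shiftedL N α 0 x := by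
  have hinv : (S N α)⁻¹ = Matrix.diagonal fun i : Fin N => (((α (i + 1))⁻¹ : ℝ) : ℂ) := by
    refine Matrix.inv_eq_right_inv ?_
    rw [S, Matrix.diagonal_mul_diagonal, ← Matrix.diagonal_one]
    congr 1
    ext i
    rw [← Complex.ofReal_mul, mul_inv_cancel₀ (hα _ (by omega) (by omega)), Complex.ofReal_one]
  ext i j
  rw [Lα, hinv, Matrix.mul_diagonal, S, Matrix.diagonal_mul, shiftedL, L, Matrix.of_apply,
    Matrix.of_apply, zero_add, invFact]
  by_cases h : j ≤ i
  · have h' : (j : ℕ) ≤ i := h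
    rw [if_pos h, if_pos h']
    push_cast
    ring
  · have h' : ¬ (j : ℕ) ≤ i := h
    rw [if_neg h, if_neg h']
    simp

/-- The nilpotent subdiagonal shift, conjugated by `S^α`. -/
def lowerShift (N : ℕ) (α : ℕ → ℝ) : Matrix (Fin N) (Fin N) ℂ :=
  Matrix.of fun i j => if (i : ℕ) = j + 1 then ((α (i + 1) / α (j + 1) : ℝ) : ℂ) else 0

theorem lowerShift_mul_apply (B : Matrix (Fin N) (Fin N) ℂ) (i j : Fin N) :
    (lowerShift N α * B) i j
      = if h : 0 < (i : ℕ) then ((α (i + 1) / α i : ℝ) : ℂ) * B ⟨i - 1, by omega⟩ j else 0 := by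
  rw [Matrix.mul_apply]
  split_ifs with h
  · rw [Finset.sum_eq_single ⟨i - 1, by omega⟩]
    · have e : (i : ℕ) = i - 1 + 1 := by omega
      simp only [lowerShift, Matrix.of_apply]
      rw [if_pos e, ← e]
    · intro k _ hk
      rw [lowerShift, Matrix.of_apply, if_neg, zero_mul]
      rintro h'
      exact hk (Fin.ext (by simp [h']))
    · simp
  · refine Finset.sum_eq_zero fun k _ => ?_
    rw [lowerShift, Matrix.of_apply, if_neg (by omega), zero_mul]

/-- The shift turns `1/(i-j)!` into `1/(i-1-j)! = (i-j)/(i-j)!`. The truncated Hermite index is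
harmless, since the coefficient vanishes whenever `i ≤ j`. -/
theorem lowerShift_mul_shiftedL (hα : ∀ k, 1 ≤ k → k ≤ N → α k ≠ 0) (m : ℕ) (x : ℝ)
    (i j : Fin N) :
    (lowerShift N α * shiftedL N α m x) i j
      = ((α (i + 1) / α (j + 1) * (invFact i j * (i - j)
        * (hermiteH (m + i - j - 1)).eval x) : ℝ) : ℂ) := by
  rw [lowerShift_mul_apply]
  split_ifs with h
  · rw [shiftedL, Matrix.of_apply, ← Complex.ofReal_mul, Complex.ofReal_inj]
    obtain ⟨i, hi⟩ := i
    obtain ⟨i, rfl⟩ : ∃ k, i = k + 1 := ⟨i - 1, by simp at h; omega⟩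
    have h1 := invFact_mul i j
    have h2 := hα (i + 1) (by omega) (by omega)
    have e : m + (i + 1) - (j : ℕ) - 1 = m + i - j := by omega
    simp only [Nat.add_sub_cancel]
    rw [e, ← h1]
    push_cast
    field_simp
  · have hi : (i : ℕ) = 0 := by omega
    rcases Nat.eq_zero_or_pos (j : ℕ) with hj | hj
    · simp [hi, hj]
    · rw [invFact_of_lt (by omega)]; simp

theorem shiftedL_one (hα : ∀ k, 1 ≤ k → k ≤ N → α k ≠ 0) (x : ℝ) :
    shiftedL N α 1 x = (2 : ℂ) • ((x : ℂ) • shiftedL N α 0 x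
      - lowerShift N α * shiftedL N α 0 x) := by
  ext i j
  rw [Matrix.smul_apply, Matrix.sub_apply, Matrix.smul_apply, lowerShift_mul_shiftedL hα]
  simp only [shiftedL, Matrix.of_apply, smul_eq_mul]
  rw [← Complex.ofReal_mul, ← Complex.ofReal_sub, ← Complex.ofReal_ofNat, ← Complex.ofReal_mul,
    Complex.ofReal_inj]
  rcases lt_or_ge (i : ℕ) j with h | h
  · rw [invFact_of_lt h]; ring
  · obtain ⟨e, he⟩ := Nat.exists_eq_add_of_le h
    rw [he, show 1 + ((j : ℕ) + e) - j = e + 1 by omega, show 0 + ((j : ℕ) + e) - j = e by omega]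
    rcases e with _ | e
    · simp [hermiteH]; ring
    · rw [hermiteH_add_two]
      simp
      ring

theorem shiftedL_add_two (hα : ∀ k, 1 ≤ k → k ≤ N → α k ≠ 0) (m : ℕ) (x : ℝ) :
    shiftedL N α (m + 2) x = (2 : ℂ) • ((x : ℂ) • shiftedL N α (m + 1) x
      - lowerShift N α * shiftedL N α (m + 1) x - ((m : ℂ) + 1) • shiftedL N α m x) := by
  ext i j
  rw [Matrix.smul_apply, Matrix.sub_apply, Matrix.sub_apply, Matrix.smul_apply,
    Matrix.smul_apply, lowerShift_mul_shiftedL hα]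
  simp only [shiftedL, Matrix.of_apply, smul_eq_mul]
  rw [show ((m : ℂ) + 1) = ((m + 1 : ℝ) : ℂ) by push_cast; ring]
  rw [← Complex.ofReal_mul, ← Complex.ofReal_mul, ← Complex.ofReal_sub, ← Complex.ofReal_sub,
    ← Complex.ofReal_ofNat, ← Complex.ofReal_mul, Complex.ofReal_inj]
  rcases lt_or_ge (i : ℕ) j with h | h
  · rw [invFact_of_lt h]; ring
  · obtain ⟨e, he⟩ := Nat.exists_eq_add_of_le h
    rw [he, show m + 2 + ((j : ℕ) + e) - j = m + e + 2 by omega,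
      show m + 1 + ((j : ℕ) + e) - j = m + e + 1 by omega,
      show m + ((j : ℕ) + e) - j = m + e by omega, Nat.add_sub_cancel, hermiteH_add_two]
    simp
    ring

/-- The matrix polynomial `H_m(x - A)`, where `A` is the lower shift. -/
def hermiteShift (N : ℕ) (α : ℕ → ℝ) : ℕ → (Matrix (Fin N) (Fin N) ℂ)[X]
  | 0 => 1
  | 1 => (2 : ℂ) • (X - C (lowerShift N α))
  | m + 2 => (2 : ℂ) • (X * hermiteShift N α (m + 1) - C (lowerShift N α) * hermiteShift N α (m + 1)
      - ((m : ℂ) + 1) • hermiteShift N α m)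

theorem evalAt_X_mul (P : (Matrix (Fin N) (Fin N) ℂ)[X]) (x : ℝ) :
    evalAt (X * P) x = (x : ℂ) • evalAt P x := by
  rw [evalAt, ← X_mul.symm, eval_mul_X, evalAt]
  ext i j
  simp [mul_comm]

/-- Both sides obey the same three-term recurrence in `m`: in each entry the shift contributes `i -
j`, which completes `m + 1` to the coefficient `m + 1 + i - j` of the scalar recurrence. -/
theorem evalAt_hermiteShift_mul (hα : ∀ k, 1 ≤ k → k ≤ N → α k ≠ 0) (x : ℝ) (m : ℕ) :
    evalAt (hermiteShift N α m) x * shiftedL N α 0 x = shiftedL N α m x := by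
  induction m using Nat.twoStepInduction with
  | zero => simp [hermiteShift, evalAt]
  | one =>
    have h : evalAt (hermiteShift N α 1) x = (2 : ℂ) • ((x : ℂ) • 1 - lowerShift N α) := by
      rw [hermiteShift]
      have h1 := evalAt_X_mul (1 : (Matrix (Fin N) (Fin N) ℂ)[X]) x
      simp only [evalAt, mul_one, eval_one] at h1
      simp only [evalAt, eval_smul, eval_sub, eval_C, h1]
    rw [h, shiftedL_one hα, smul_mul_assoc, sub_mul, smul_mul_assoc, one_mul]
  | more m ih1 ih2 =>
    have h : evalAt (hermiteShift N α (m + 2)) x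
        = (2 : ℂ) • ((x : ℂ) • evalAt (hermiteShift N α (m + 1)) x
          - lowerShift N α * evalAt (hermiteShift N α (m + 1)) x
          - ((m : ℂ) + 1) • evalAt (hermiteShift N α m) x) := by
      rw [hermiteShift, ← evalAt_X_mul]
      simp only [evalAt, eval_smul, eval_sub, eval_C_mul]
    rw [h, shiftedL_add_two hα, smul_mul_assoc, sub_mul, sub_mul, smul_mul_assoc, smul_mul_assoc,
      mul_assoc, ih1, ih2]

theorem coeff_hermiteShift (m : ℕ) : ∀ k, m ≤ k → (hermiteShift N α m).coeff k
    = if k = m then (2 : ℂ) ^ m • (1 : Matrix (Fin N) (Fin N) ℂ) else 0 := by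
  induction m using Nat.twoStepInduction with
  | zero => intro k _; simp [hermiteShift, coeff_one]
  | one =>
    intro k hk
    obtain ⟨k, rfl⟩ := Nat.exists_eq_add_of_le' hk
    rw [hermiteShift, coeff_smul, coeff_sub, coeff_C_succ, coeff_X, sub_zero]
    rcases Nat.eq_zero_or_pos k with h | h
    · simp [h]
    · rw [if_neg (by omega), if_neg (by omega), smul_zero]
  | more m ih1 ih2 =>
    intro k hk
    obtain ⟨k, rfl⟩ := Nat.exists_eq_add_of_le' (show 1 ≤ k by omega)
    rw [hermiteShift, coeff_smul, coeff_sub, coeff_sub, coeff_X_mul, coeff_C_mul, coeff_smul,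
      ih2 k (by omega), ih2 (k + 1) (by omega), ih1 (k + 1) (by omega),
      if_neg (show ¬ k + 1 = m by omega), if_neg (show ¬ k + 1 = m + 1 by omega)]
    by_cases h : k = m + 1
    · subst h; simp [smul_smul, pow_succ, mul_comm]
    · rw [if_neg h, if_neg (by omega)]; simp

/-- The coefficient of `H_{n-t}(x - A)` in the `n`-th monic orthogonal polynomial. -/
def hahnMatrix (N : ℕ) (α : ℕ → ℝ) (q : ℝ) (n t : ℕ) : Matrix (Fin N) (Fin N) ℂ :=
  Matrix.of fun i j =>
    if (j : ℕ) = i + t then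
      (((2 ^ n)⁻¹ * (α (i + 1) / α (j + 1)) * hahnCoeff N q n i t : ℝ) : ℂ)
    else 0

theorem hahnMatrix_zero (hα : ∀ k, 1 ≤ k → k ≤ N → α k ≠ 0) (q : ℝ) (n : ℕ) :
    hahnMatrix N α q n 0 = ((2 : ℂ) ^ n)⁻¹ • 1 := by
  ext i j
  rw [hahnMatrix, Matrix.of_apply, Matrix.smul_apply, Matrix.one_apply, add_zero]
  by_cases h : i = j
  · subst h
    rw [if_pos rfl, if_pos rfl, hahnCoeff_zero, div_self (hα _ (by omega) (by omega))]
    simp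
  · rw [if_neg (fun h' => h (Fin.ext h'.symm)), if_neg h, smul_zero]

/-- The monic matrix valued Hermite polynomials. -/
def monicHermite (N : ℕ) (α : ℕ → ℝ) (q : ℝ) (n : ℕ) : (Matrix (Fin N) (Fin N) ℂ)[X] :=
  ∑ t ∈ Finset.range (n + 1), C (hahnMatrix N α q n t) * hermiteShift N α (n - t)

theorem coeff_monicHermite (hα : ∀ k, 1 ≤ k → k ≤ N → α k ≠ 0) (q : ℝ) (n k : ℕ)
    (hk : n ≤ k) : (monicHermite N α q n).coeff k = if k = n then 1 else 0 := by
  rw [monicHermite, finsetSum_coeff, Finset.sum_range_succ', Finset.sum_eq_zero, zero_add,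
    coeff_C_mul, Nat.sub_zero, coeff_hermiteShift n k hk, hahnMatrix_zero hα]
  · split_ifs
    · rw [smul_mul_smul_comm, inv_mul_cancel₀ (by simp), one_smul, one_mul]
    · rw [mul_zero]
  · intro t ht
    have ht := Finset.mem_range.1 ht
    rw [coeff_C_mul, coeff_hermiteShift _ k (by omega), if_neg (by omega), mul_zero]

theorem natDegree_monicHermite (hN : 1 ≤ N) (hα : ∀ k, 1 ≤ k → k ≤ N → α k ≠ 0) (q : ℝ)
    (n : ℕ) : (monicHermite N α q n).natDegree = n := by
  have : Nonempty (Fin N) := ⟨⟨0, hN⟩⟩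
  refine natDegree_eq_of_le_of_coeff_ne_zero ?_ ?_
  · rw [natDegree_le_iff_coeff_eq_zero]
    intro k hk
    rw [coeff_monicHermite hα q n k hk.le, if_neg hk.ne']
  · rw [coeff_monicHermite hα q n n le_rfl, if_pos rfl]
    exact one_ne_zero

theorem monic_monicHermite (hN : 1 ≤ N) (hα : ∀ k, 1 ≤ k → k ≤ N → α k ≠ 0) (q : ℝ)
    (n : ℕ) : (monicHermite N α q n).Monic := by
  rw [Monic, leadingCoeff, natDegree_monicHermite hN hα, coeff_monicHermite hα q n n le_rfl,
    if_pos rfl]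

/-- The coefficient matrix of `H_{n-t}(x - A)` sends row `i` to row `i + t`, so every term carries
the same Hermite index `(n - t) + (i + t) - j`, and the scalars add up to `hahnVec`. -/
theorem evalAt_monicHermite_mul (hα : ∀ k, 1 ≤ k → k ≤ N → α k ≠ 0) (q : ℝ) (n : ℕ) (x : ℝ)
    (i j : Fin N) :
    (evalAt (monicHermite N α q n) x * Lα N α x) i j
      = (((2 ^ n)⁻¹ * (α (i + 1) / α (j + 1)) * hahnVec N q n i j
        * (hermiteH (n + i - j)).eval x : ℝ) : ℂ) := by
  have h : evalAt (monicHermite N α q n) x * Lα N α x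
      = ∑ t ∈ Finset.range (n + 1), hahnMatrix N α q n t * shiftedL N α (n - t) x := by
    rw [Lα_eq_shiftedL hα, monicHermite, evalAt, eval_finsetSum, Finset.sum_mul]
    refine Finset.sum_congr rfl fun t _ => ?_
    rw [eval_C_mul, mul_assoc, ← evalAt_hermiteShift_mul hα x (n - t)]
    rfl
  rw [h, Matrix.sum_apply, hahnVec, Finset.mul_sum, Finset.sum_mul, Complex.ofReal_sum]
  refine Finset.sum_congr rfl fun t ht => ?_
  have ht := Finset.mem_range.1 ht
  rw [Matrix.mul_apply]
  by_cases hit : (i : ℕ) + t < N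
  · rw [Finset.sum_eq_single ⟨i + t, hit⟩]
    · rw [hahnMatrix, shiftedL, Matrix.of_apply, Matrix.of_apply, if_pos rfl,
        ← Complex.ofReal_mul, Complex.ofReal_inj, show n - t + ((i : ℕ) + t) = n + i by omega]
      have := hα (i + t + 1) (by omega) (by omega)
      field_simp
    · intro k _ hk
      rw [hahnMatrix, Matrix.of_apply, if_neg (fun h => hk (Fin.ext h)), zero_mul]
    · simp
  · rw [hahnCoeff_eq_zero (Or.inl (by omega))]
    simp only [zero_mul, mul_zero, Complex.ofReal_zero]
    refine Finset.sum_eq_zero fun k _ => ?_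
    rw [hahnMatrix, Matrix.of_apply, if_neg (by omega), zero_mul]

/-! ### Connection formula for the explicit polynomials -/

theorem sum_connMatrix_mul_hahnMatrix {q : ℝ → ℝ} {ν lam : ℝ}
    (hα : ∀ k, 1 ≤ k → k ≤ N → α k ≠ 0)
    (hν : ∀ p : ℕ, 0 < q (ν + p)) (hlam : ∀ p : ℕ, 0 < q (lam + p))
    (hν' : 2 ≤ N → ∀ p : ℕ, q (ν + p) = q ν + p)
    (hlam' : 2 ≤ N → ∀ p : ℕ, q (lam + p) = q lam + p)
    {n T : ℕ} (hT : T ≤ n) :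
    ∑ k ∈ Finset.range (T + 1), connMatrix N α q ν lam n k
        * hahnMatrix N α (q lam) (n - k) (T - k) = hahnMatrix N α (q ν) n T := by
  have hq : 0 < q ν := by simpa using hν 0
  have hl : 0 < q lam := by simpa using hlam 0
  ext i j
  rw [Matrix.sum_apply]
  by_cases hj : (j : ℕ) = i + T
  · rw [hahnMatrix, Matrix.of_apply, if_pos hj, ← sum_connRed_mul_hahnCoeff hq hl
      (by omega) hT, Finset.mul_sum, Complex.ofReal_sum]
    refine Finset.sum_congr rfl fun k hk => ?_
    have hk := Finset.mem_range.1 hk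
    rw [Matrix.mul_apply, Finset.sum_eq_single ⟨i + k, by omega⟩]
    · rw [connMatrix, hahnMatrix, Matrix.of_apply, Matrix.of_apply, if_pos rfl,
        if_pos (show (j : ℕ) = i + k + (T - k) by omega),
        connCoeff_eq α hν hlam hν' hlam' (by omega) (by omega), ← Complex.ofReal_mul,
        Complex.ofReal_inj, show (i : ℕ) + 1 + k = i + k + 1 by omega]
      have h1 := hα (i + k + 1) (by omega) (by omega)
      have h2 := hα (j + 1) (by omega) (by omega)
      have h3 : (2 : ℝ) ^ n = 2 ^ (n - k) * 2 ^ k := by rw [← pow_add]; congr 1; omega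
      rw [h3]
      field_simp
    · intro l _ hl
      rw [connMatrix, Matrix.of_apply, if_neg (fun h => hl (Fin.ext h)), zero_mul]
    · simp
  · rw [hahnMatrix, Matrix.of_apply, if_neg hj]
    refine Finset.sum_eq_zero fun k hk => ?_
    have hk := Finset.mem_range.1 hk
    rw [Matrix.mul_apply]
    refine Finset.sum_eq_zero fun l _ => ?_
    rw [connMatrix, hahnMatrix, Matrix.of_apply, Matrix.of_apply]
    by_cases h1 : (l : ℕ) = i + k
    · rw [if_neg (show ¬ (j : ℕ) = l + (T - k) by omega), mul_zero]
    · rw [if_neg h1, zero_mul]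

theorem monicHermite_eq_sum {q : ℝ → ℝ} {ν lam : ℝ}
    (hα : ∀ k, 1 ≤ k → k ≤ N → α k ≠ 0)
    (hν : ∀ p : ℕ, 0 < q (ν + p)) (hlam : ∀ p : ℕ, 0 < q (lam + p))
    (hν' : 2 ≤ N → ∀ p : ℕ, q (ν + p) = q ν + p)
    (hlam' : 2 ≤ N → ∀ p : ℕ, q (lam + p) = q lam + p) (n : ℕ) :
    monicHermite N α (q ν) n = ∑ k ∈ Finset.range (N + 1),
      if k ≤ n then C (connMatrix N α q ν lam n k) * monicHermite N α (q lam) (n - k) else 0 := by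
  have hzero : ∀ k, N ≤ k → connMatrix N α q ν lam n k = 0 := by
    intro k hk
    ext i j
    rw [connMatrix, Matrix.of_apply, if_neg (by omega), Matrix.zero_apply]
  have h1 : ∑ k ∈ Finset.range (N + 1),
      (if k ≤ n then C (connMatrix N α q ν lam n k) * monicHermite N α (q lam) (n - k) else 0)
      = ∑ k ∈ Finset.range (n + 1),
        C (connMatrix N α q ν lam n k) * monicHermite N α (q lam) (n - k) := by
    rw [← Finset.sum_filter]
    refine Finset.sum_subset ?_ ?_
    · intro k hk
      rw [Finset.mem_filter] at hk
      exact Finset.mem_range.2 (by omega)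
    · intro k hk hk'
      have hk := Finset.mem_range.1 hk
      rw [hzero k, C_0, zero_mul]
      by_contra hlt
      exact hk' (Finset.mem_filter.2 ⟨Finset.mem_range.2 (by omega), by omega⟩)
  have h2 : ∀ k ∈ Finset.range (n + 1),
      C (connMatrix N α q ν lam n k) * monicHermite N α (q lam) (n - k)
      = ∑ T ∈ Finset.Ico k (n + 1), C (connMatrix N α q ν lam n k
        * hahnMatrix N α (q lam) (n - k) (T - k)) * hermiteShift N α (n - T) := by
    intro k hk
    have hk := Finset.mem_range.1 hk
    rw [Finset.sum_Ico_eq_sum_range, monicHermite, Finset.mul_sum,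
      show n + 1 - k = n - k + 1 by omega]
    refine Finset.sum_congr rfl fun t _ => ?_
    rw [C_mul, mul_assoc, Nat.add_sub_cancel_left, Nat.sub_sub]
  -- Regrouping by the total drop `T = k + t` collects the coefficient of each `H_{n-T}(x - A)`.
  rw [h1, Finset.sum_congr rfl h2, Finset.sum_comm' (s' := fun T => Finset.range (T + 1))
    (t' := Finset.range (n + 1)), monicHermite]
  · refine Finset.sum_congr rfl fun T hT => ?_
    rw [← Finset.sum_mul, ← map_sum, sum_connMatrix_mul_hahnMatrix hα hν hlam hν' hlam'
      (Nat.lt_succ_iff.1 (Finset.mem_range.1 hT))]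
  · intro k T
    simp only [Finset.mem_range, Finset.mem_Ico]
    omega

/-! ### Integrability and the matrix valued form -/

/-- The functions on the real line given by complex polynomials. -/
def IsPolyFun (f : ℝ → ℂ) : Prop := ∃ p : ℂ[X], ∀ x : ℝ, f x = p.eval (x : ℂ)

theorem IsPolyFun.const_mul {f : ℝ → ℂ} (hf : IsPolyFun f) (a : ℂ) :
    IsPolyFun fun x => a * f x := by
  obtain ⟨p, hp⟩ := hf
  exact ⟨C a * p, fun x => by simp [hp]⟩

theorem IsPolyFun.mul {f g : ℝ → ℂ} (hf : IsPolyFun f) (hg : IsPolyFun g) :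
    IsPolyFun fun x => f x * g x := by
  obtain ⟨p, hp⟩ := hf
  obtain ⟨q, hq⟩ := hg
  exact ⟨p * q, fun x => by simp [hp, hq]⟩

theorem IsPolyFun.sum {ι : Type*} (s : Finset ι) {f : ι → ℝ → ℂ} (hf : ∀ i, IsPolyFun (f i)) :
    IsPolyFun fun x => ∑ i ∈ s, f i x := by
  choose p hp using hf
  exact ⟨∑ i ∈ s, p i, fun x => by simp [hp, eval_finsetSum]⟩

theorem IsPolyFun.star {f : ℝ → ℂ} (hf : IsPolyFun f) : IsPolyFun fun x => star (f x) := by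
  obtain ⟨p, hp⟩ := hf
  refine ⟨p.map (starRingEnd ℂ), fun x => ?_⟩
  have h := hom_eval₂ p (RingHom.id ℂ) (starRingEnd ℂ) (x : ℂ)
  simp only [hp]
  rw [eval_map]
  simpa [eval₂_id] using h

theorem IsPolyFun.integrable {f : ℝ → ℂ} (hf : IsPolyFun f) :
    MeasureTheory.Integrable fun x : ℝ => (Real.exp (-x ^ 2) : ℂ) * f x := by
  obtain ⟨p, hp⟩ := hf
  simpa only [hp] using integrable_gaussian_mul_eval p

theorem isPolyFun_evalAt (P : (Matrix (Fin N) (Fin N) ℂ)[X]) (i j : Fin N) :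
    IsPolyFun fun x => evalAt P x i j := by
  refine ⟨matPolyEquiv.symm P i j, fun x => ?_⟩
  simp only [evalAt]
  rw [ ← matPolyEquiv_symm_map_eval, Matrix.map_apply]

theorem isPolyFun_evalAt_mul (hα : ∀ k, 1 ≤ k → k ≤ N → α k ≠ 0)
    (P : (Matrix (Fin N) (Fin N) ℂ)[X]) (i j : Fin N) :
    IsPolyFun fun x => (evalAt P x * Lα N α x) i j := by
  simp only [Matrix.mul_apply]
  refine IsPolyFun.sum _ fun k => (isPolyFun_evalAt P i k).mul ?_
  refine ⟨((C (α (k + 1) / α (j + 1)) * (C (invFact k j) * hermiteH (0 + k - j))).map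
    Complex.ofRealHom), fun x => ?_⟩
  have h := eval₂_at_apply (p := C (α (k + 1) / α (j + 1)) * (C (invFact k j)
    * hermiteH (0 + k - j))) Complex.ofRealHom x
  simp only [Lα_eq_shiftedL hα, shiftedL, Matrix.of_apply]
  rw [eval_map]
  simpa using h.symm

theorem mul_W_mul_apply (δ : ℕ → ℝ) (A B : Matrix (Fin N) (Fin N) ℂ) (x : ℝ) (i k : Fin N) :
    (A * W N α δ x * Bᴴ) i k = ∑ j : Fin N, (Real.exp (-x ^ 2) : ℂ)
      * ((δ (j + 1) : ℂ) * ((A * Lα N α x) i j * star ((B * Lα N α x) k j))) := by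
  have h : A * W N α δ x * Bᴴ = (A * Lα N α x) * T N δ x * (B * Lα N α x)ᴴ := by
    rw [W, conjTranspose_mul]; simp only [mul_assoc]
  rw [h, Matrix.mul_apply]
  refine Finset.sum_congr rfl fun j _ => ?_
  rw [T, Matrix.mul_diagonal, Matrix.conjTranspose_apply]
  push_cast
  ring

theorem integrable_form (hα : ∀ k, 1 ≤ k → k ≤ N → α k ≠ 0) (δ : ℕ → ℝ)
    (P Q : (Matrix (Fin N) (Fin N) ℂ)[X]) (i k : Fin N) :
    MeasureTheory.Integrable fun x => (evalAt P x * W N α δ x * (evalAt Q x)ᴴ) i k := by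
  simp only [mul_W_mul_apply]
  refine MeasureTheory.integrable_finsetSum _ fun j _ => IsPolyFun.integrable ?_
  exact ((isPolyFun_evalAt_mul hα P i j).mul (isPolyFun_evalAt_mul hα Q k j).star).const_mul _

/-- The form as an additive map in its first argument. -/
def formHom (hα : ∀ k, 1 ≤ k → k ≤ N → α k ≠ 0) (δ : ℕ → ℝ)
    (Q : (Matrix (Fin N) (Fin N) ℂ)[X]) :
    (Matrix (Fin N) (Fin N) ℂ)[X] →+ Matrix (Fin N) (Fin N) ℂ :=
  AddMonoidHom.mk' (fun P => form (W N α δ) P Q) fun P P' => by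
    ext i k
    simp only [form, Matrix.of_apply, Matrix.add_apply]
    rw [← MeasureTheory.integral_add (integrable_form hα δ P Q i k)
      (integrable_form hα δ P' Q i k)]
    simp only [evalAt, eval_add, add_mul, Matrix.add_apply]

theorem formHom_apply (hα : ∀ k, 1 ≤ k → k ≤ N → α k ≠ 0) (δ : ℕ → ℝ)
    (P Q : (Matrix (Fin N) (Fin N) ℂ)[X]) : formHom hα δ Q P = form (W N α δ) P Q := rfl

theorem form_C_mul (hα : ∀ k, 1 ≤ k → k ≤ N → α k ≠ 0) (δ : ℕ → ℝ)
    (A : Matrix (Fin N) (Fin N) ℂ) (P Q : (Matrix (Fin N) (Fin N) ℂ)[X]) :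
    form (W N α δ) (C A * P) Q = A * form (W N α δ) P Q := by
  ext i k
  have h1 : ∀ x : ℝ, (evalAt (C A * P) x * W N α δ x * (evalAt Q x)ᴴ) i k
      = ∑ l : Fin N, A i l * (evalAt P x * W N α δ x * (evalAt Q x)ᴴ) l k := by
    intro x
    rw [← Matrix.mul_apply, evalAt, eval_C_mul]
    simp only [evalAt, mul_assoc]
  simp only [form, Matrix.of_apply, h1]
  rw [Matrix.mul_apply]
  rw [MeasureTheory.integral_finsetSum]
  · exact Finset.sum_congr rfl fun l _ => MeasureTheory.integral_const_mul _ _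
  · intro l _
    exact (integrable_form hα δ P Q l k).const_mul _

theorem form_monicHermite (hα : ∀ k, 1 ≤ k → k ≤ N → α k ≠ 0) (δ : ℕ → ℝ) (q : ℝ) (n m : ℕ)
    (i k : Fin N) :
    form (W N α δ) (monicHermite N α q n) (monicHermite N α q m) i k
      = ((∑ j ∈ Finset.range N, δ (j + 1) * (((2 ^ n)⁻¹ * (α (i + 1) / α (j + 1))
          * hahnVec N q n i j) * ((2 ^ m)⁻¹ * (α (k + 1) / α (j + 1)) * hahnVec N q m k j))
          * gaussInt (hermiteH (n + i - j) * hermiteH (m + k - j)) : ℝ) : ℂ) := by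
  rw [form, Matrix.of_apply, Finset.sum_range]
  simp only [mul_W_mul_apply, evalAt_monicHermite_mul hα]
  have hstar : ∀ r : ℝ, star (r : ℂ) = r := Complex.conj_ofReal
  simp only [hstar, ← Complex.ofReal_mul, ← Complex.ofReal_sum]
  rw [integral_complex_ofReal, Complex.ofReal_inj]
  rw [← show ∑ j : Fin N, ∫ x : ℝ, _ = _ from (MeasureTheory.integral_finsetSum _ ?_).symm]
  · refine Finset.sum_congr rfl fun j _ => ?_
    rw [gaussInt, ← MeasureTheory.integral_const_mul]
    congr 1
    ext x
    rw [eval_mul]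
    ring
  · intro j _
    refine ((integrable_gaussian_mul_eval_real
      (hermiteH (n + i - j) * hermiteH (m + k - j))).const_mul
      (δ (j + 1) * (((2 ^ n)⁻¹ * (α (i + 1) / α (j + 1))
          * hahnVec N q n i j) * ((2 ^ m)⁻¹ * (α (k + 1) / α (j + 1))
          * hahnVec N q m k j)))).congr (Filter.Eventually.of_forall fun x => ?_)
    simp only [eval_mul]
    ring

/-! ### Orthogonality and uniqueness -/

/-- The conditions on the weight under which `monicHermite N α q` is orthogonal. -/
structure HahnWeight (N : ℕ) (α δ : ℕ → ℝ) (q : ℝ) : Prop where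
  α_ne : ∀ k, 1 ≤ k → k ≤ N → α k ≠ 0
  δ_pos : ∀ k, 1 ≤ k → k ≤ N → 0 < δ k
  q_pos : 0 < q
  ratio : ∀ j : ℕ, j + 1 < N → δ (j + 2) / α (j + 2) ^ 2 * ((j + 1) * (N - 1 - j))
    = 2 * (j + 1 + q) * (δ (j + 1) / α (j + 1) ^ 2)

theorem form_monicHermite_of_add_ne {δ : ℕ → ℝ} {q : ℝ} (h : HahnWeight N α δ q) {n m : ℕ}
    {i k : Fin N} (hne : n + i ≠ m + k) :
    form (W N α δ) (monicHermite N α q n) (monicHermite N α q m) i k = 0 := by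
  rw [form_monicHermite h.α_ne, Finset.sum_eq_zero, Complex.ofReal_zero]
  intro j _
  by_cases h1 : n + i < j
  · rw [hahnVec_eq_zero i.2 (Or.inr h1)]; ring
  by_cases h2 : m + k < j
  · rw [hahnVec_eq_zero k.2 (Or.inr h2)]; ring
  rw [gaussInt_hermiteH_mul, if_neg (by omega), mul_zero]

theorem form_monicHermite_of_ne {δ : ℕ → ℝ} {q : ℝ} (h : HahnWeight N α δ q) {n m : ℕ}
    (hne : n ≠ m) : form (W N α δ) (monicHermite N α q n) (monicHermite N α q m) = 0 := by
  ext i k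
  by_cases hs : n + (i : ℕ) = m + k
  swap
  · rw [form_monicHermite_of_add_ne h hs, Matrix.zero_apply]
  -- With `s = n + i`, the norm ratio `‖H_{s-j}‖² = 2(s-j)‖H_{s-j-1}‖²` combined with
  -- `HahnWeight.ratio` gives the detailed balance condition.
  have horth := hahnVec_orthogonal h.q_pos i.2 k.2 hs hne
    (fun j => δ (j + 1) / α (j + 1) ^ 2 * hermiteNorm (n + i - j)) (by
      intro j hj hjs
      obtain ⟨e, he⟩ := Nat.exists_eq_add_of_le hjs
      have heR : (n : ℝ) + (i : ℕ) = j + 1 + e := by exact_mod_cast he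
      have hr := h.ratio j hj
      rw [show n + (i : ℕ) - (j + 1) = e by omega, show n + (i : ℕ) - j = e + 1 by omega,
        hermiteNorm_succ, heR]
      linear_combination (e + 1) * hermiteNorm e * hr)
  rw [form_monicHermite h.α_ne, Matrix.zero_apply, Complex.ofReal_eq_zero]
  rw [← Finset.sum_subset (s₁ := Finset.range (min N (n + i + 1)))]
  · rw [Finset.sum_congr rfl (g := fun j => ((2 ^ n)⁻¹ * (2 ^ m)⁻¹ * α (i + 1) * α (k + 1))
      * (δ (j + 1) / α (j + 1) ^ 2 * hermiteNorm (n + i - j)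
        * (hahnVec N q n i j * hahnVec N q m k j))), ← Finset.mul_sum, horth, mul_zero]
    intro j _
    rw [gaussInt_hermiteH_mul, if_pos (by omega)]
    ring
  · intro j hj
    have := Finset.mem_range.1 hj
    exact Finset.mem_range.2 (by omega)
  · intro j hj hj'
    have h1 := Finset.mem_range.1 hj
    rw [Finset.mem_range, not_lt] at hj'
    rw [hahnVec_eq_zero i.2 (Or.inr (by omega))]
    ring

theorem form_monicHermite_self_ne_zero {δ : ℕ → ℝ} {q : ℝ} (h : HahnWeight N α δ q) (n : ℕ)
    (i : Fin N) : form (W N α δ) (monicHermite N α q n) (monicHermite N α q n) i i ≠ 0 := by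
  rw [form_monicHermite h.α_ne, Complex.ofReal_ne_zero]
  have hi := i.2
  refine (Finset.sum_pos' (fun j hj => ?_)
    ⟨min (i + n) (N - 1), Finset.mem_range.2 (by omega), ?_⟩).ne'
  · have := Finset.mem_range.1 hj
    rw [gaussInt_hermiteH_mul, if_pos rfl]
    exact mul_nonneg (mul_nonneg (h.δ_pos _ (by omega) (by omega)).le (mul_self_nonneg _))
      (hermiteNorm_pos _).le
  · rw [gaussInt_hermiteH_mul, if_pos rfl]
    refine mul_pos (mul_pos (h.δ_pos _ (by omega) (by omega)) (mul_self_pos.2 ?_))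
      (hermiteNorm_pos _)
    refine mul_ne_zero (mul_ne_zero (by positivity) (div_ne_zero (h.α_ne _ (by omega) (by omega))
      (h.α_ne _ (by omega) (by omega)))) (hahnVec_ne_zero h.q_pos hi)

theorem eq_zero_of_mul_form_monicHermite {δ : ℕ → ℝ} {q : ℝ} (h : HahnWeight N α δ q) (n : ℕ)
    {A : Matrix (Fin N) (Fin N) ℂ}
    (hA : A * form (W N α δ) (monicHermite N α q n) (monicHermite N α q n) = 0) : A = 0 := by
  ext i k
  have h1 := congrFun (congrFun hA i) k
  rw [Matrix.mul_apply, Finset.sum_eq_single k, Matrix.zero_apply] at h1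
  · exact (mul_eq_zero.1 h1).resolve_right (form_monicHermite_self_ne_zero h n k)
  · intro j _ hj
    rw [form_monicHermite_of_add_ne h (fun h' => hj (Fin.ext (by omega))), mul_zero]
  · simp

theorem isMonicOrthogonal_monicHermite (hN : 1 ≤ N) {δ : ℕ → ℝ} {q : ℝ}
    (h : HahnWeight N α δ q) : IsMonicOrthogonal (W N α δ) (monicHermite N α q) where
  monic := monic_monicHermite hN h.α_ne q
  natDegree_eq := natDegree_monicHermite hN h.α_ne q
  orthogonal _ _ hne := form_monicHermite_of_ne h hne

/-- Monicity permits division from the top degree down over a noncommutative ring, with coefficients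
on the left. -/
theorem exists_eq_sum_C_mul_of_monic {R : Type*} [Ring R] {P : ℕ → R[X]}
    (hP : ∀ n, (P n).Monic) (hdeg : ∀ n, (P n).natDegree = n) (n : ℕ) :
    ∀ D : R[X], (∀ k, n ≤ k → D.coeff k = 0) →
      ∃ a : ℕ → R, D = ∑ m ∈ Finset.range n, C (a m) * P m := by
  induction n with
  | zero =>
    intro D hD
    exact ⟨0, by ext k; simpa using hD k (Nat.zero_le k)⟩
  | succ n ih =>
    intro D hD
    obtain ⟨a, ha⟩ := ih (D - C (D.coeff n) * P n) (by
      intro k hk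
      rw [coeff_sub, coeff_C_mul]
      rcases hk.eq_or_lt with h | h
      · subst h
        have := (hP n).coeff_natDegree
        rw [hdeg] at this
        rw [this, mul_one, sub_self]
      · rw [hD k h, coeff_eq_zero_of_natDegree_lt (p := P n) (by rwa [hdeg]), mul_zero, sub_zero])
    refine ⟨fun m => if m = n then D.coeff n else a m, ?_⟩
    rw [Finset.sum_range_succ, Finset.sum_congr rfl (g := fun m => C (a m) * P m), ← ha]
    · simp
    · intro m hm
      simp only [if_neg (Finset.mem_range.1 hm).ne]

theorem IsMonicOrthogonal.eq_monicHermite (hN : 1 ≤ N) {δ : ℕ → ℝ} {q : ℝ}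
    (h : HahnWeight N α δ q) {Q : ℕ → (Matrix (Fin N) (Fin N) ℂ)[X]}
    (hQ : IsMonicOrthogonal (W N α δ) Q) : Q = monicHermite N α q := by
  have hP := isMonicOrthogonal_monicHermite hN h
  ext1 n
  induction n using Nat.strong_induction_on with
  | _ n ih =>
    obtain ⟨a, ha⟩ := exists_eq_sum_C_mul_of_monic hP.monic hP.natDegree_eq n
      (Q n - monicHermite N α q n) (by
        intro k hk
        rw [coeff_sub]
        rcases hk.eq_or_lt with h' | h'
        · subst h'
          have h1 := (hQ.monic n).coeff_natDegree
          have h2 := (hP.monic n).coeff_natDegree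
          rw [hQ.natDegree_eq] at h1
          rw [hP.natDegree_eq] at h2
          rw [h1, h2, sub_self]
        · rw [coeff_eq_zero_of_natDegree_lt (by rwa [hQ.natDegree_eq]),
            coeff_eq_zero_of_natDegree_lt (by rwa [hP.natDegree_eq]), sub_zero])
    rw [← sub_eq_zero, ha]
    refine Finset.sum_eq_zero fun m hm => ?_
    have hmn := Finset.mem_range.1 hm
    -- By induction the `m`-th polynomials of both sequences agree, so the difference is orthogonal
    -- to them from the left. Thus only linearity in the first argument is needed.
    have h1 := congrArg (formHom h.α_ne δ (monicHermite N α q m)) ha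
    rw [map_sub, map_sum, formHom_apply, formHom_apply, hP.orthogonal n m hmn.ne', ← ih m hmn,
      hQ.orthogonal n m hmn.ne', sub_zero, ih m hmn, Finset.sum_eq_single m] at h1
    · rw [formHom_apply, form_C_mul h.α_ne] at h1
      rw [eq_zero_of_mul_form_monicHermite h m h1.symm, C_0, zero_mul]
    · intro l _ hl
      rw [formHom_apply, form_C_mul h.α_ne, hP.orthogonal l m hl, mul_zero]
    · intro h'
      exact absurd hm h'

/-! ### Consequences of admissibility -/

theorem Admissible.hahnWeight {δ : ℝ → ℕ → ℝ} {c d : ℝ → ℝ} {μ : ℝ}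
    (hα : ∀ k, 1 ≤ k → k ≤ N → α k ≠ 0) (h : Admissible N α δ c d μ) :
    HahnWeight N α (δ μ) (c μ / d μ) where
  α_ne := hα
  δ_pos := h.δ_pos
  q_pos := div_pos h.c_pos h.d_pos
  ratio j hj := by
    have hr := h.α_ratio (j + 1) (by omega) (by omega)
    have h1 := hα (j + 1) (by omega) (by omega)
    have h2 := hα (j + 2) (by omega) (by omega)
    have h3 := (h.δ_pos (j + 1) (by omega) (by omega)).ne'
    have hd := h.d_pos
    have hc := h.c_pos
    have h4 : d μ * ((j : ℝ) + 1) + c μ ≠ 0 := by positivity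
    have hd' := hd.ne'
    push_cast at hr
    rw [show j + 1 + 1 = j + 2 from rfl] at hr
    field_simp at hr ⊢
    linear_combination -hr

/-- Passing from `μ` to `μ + 1` multiplies `δ_2/δ_1` by `(2 + q_μ)/(1 + q_μ)`, while `α_2/α_1` stays
fixed. Comparing the two `α`-relations at `k = 1` determines `q_{μ+1}`; this needs a second index,
hence `N ≥ 2`. -/
theorem Admissible.ratio_succ (hN : 2 ≤ N) {δ : ℝ → ℕ → ℝ} {c d : ℝ → ℝ} {μ : ℝ}
    (hα : ∀ k, 1 ≤ k → k ≤ N → α k ≠ 0) (h : Admissible N α δ c d μ)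
    (h' : Admissible N α δ c d (μ + 1)) :
    c (μ + 1) / d (μ + 1) = c μ / d μ + 1 := by
  have r := (h.hahnWeight hα).ratio 0 (by omega)
  have r' := (h'.hahnWeight hα).ratio 0 (by omega)
  have e1 := h.δ_succ 1 (by omega) (by omega)
  have e2 := h.δ_succ 2 (by omega) (by omega)
  have hδ := h.δ_pos 1 (by omega) (by omega)
  have ha1 := hα 1 (by omega) (by omega)
  have hd := h.d_pos
  have hc := h.c_pos
  have hq : 0 < c μ / d μ := div_pos hc hd
  have hcq : c μ = c μ / d μ * d μ := by field_simp
  simp only [Nat.cast_zero, zero_add] at r r'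
  rw [e1, e2] at r'
  generalize c (μ + 1) / d (μ + 1) = y at *
  generalize c μ / d μ = x at *
  rw [hcq] at r'
  push_cast at r'
  have hw : 0 < δ μ 1 / α 1 ^ 2 := by positivity
  have key : (2 * (x + 1) * d μ * (δ μ 1 / α 1 ^ 2)) * (y - (x + 1)) = 0 := by
    linear_combination (2 + x) * d μ * r - r'
  have hne : 2 * (x + 1) * d μ * (δ μ 1 / α 1 ^ 2) ≠ 0 := by positivity
  linarith [(mul_eq_zero.1 key).resolve_left hne]

theorem ratio_add_nat (hN : 2 ≤ N) {δ : ℝ → ℕ → ℝ} {c d : ℝ → ℝ} {μ : ℝ}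
    (hα : ∀ k, 1 ≤ k → k ≤ N → α k ≠ 0)
    (h : ∀ p : ℕ, Admissible N α δ c d (μ + p)) (p : ℕ) :
    c (μ + p) / d (μ + p) = c μ / d μ + p := by
  induction p with
  | zero => simp
  | succ p ih =>
    have h1 := h (p + 1)
    push_cast at h1 ⊢
    rw [← add_assoc] at h1 ⊢
    rw [(h p).ratio_succ hN hα h1, ih]
    ring

end

end MVHermite

theorem mainTheorem5 (N : ℕ) (hN : 1 ≤ N) (α : ℕ → ℝ) (δ : ℝ → ℕ → ℝ) (c d : ℝ → ℝ)
    (ν lam : ℝ)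
    (hα1 : α 1 = 1) (hα : ∀ k, 1 ≤ k → k ≤ N → α k ≠ 0)
    (hν : ∀ p : ℕ, MVHermite.Admissible N α δ c d (ν + p))
    (hlam : ∀ p : ℕ, MVHermite.Admissible N α δ c d (lam + p)) :
    (∃! P, MVHermite.IsMonicOrthogonal (MVHermite.W N α (δ ν)) P) ∧
    (∃! Q, MVHermite.IsMonicOrthogonal (MVHermite.W N α (δ lam)) Q) ∧
    ∀ P Q : ℕ → Polynomial (Matrix (Fin N) (Fin N) ℂ),
      MVHermite.IsMonicOrthogonal (MVHermite.W N α (δ ν)) P →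
      MVHermite.IsMonicOrthogonal (MVHermite.W N α (δ lam)) Q →
      ∀ n : ℕ, P n = ∑ k ∈ Finset.range (N + 1),
        if k ≤ n then
          Polynomial.C (MVHermite.connMatrix N α (fun μ => c μ / d μ) ν lam n k) * Q (n - k)
        else 0 := by
  have hν0 : MVHermite.HahnWeight N α (δ ν) (c ν / d ν) := by
    simpa using (hν 0).hahnWeight hα
  have hlam0 : MVHermite.HahnWeight N α (δ lam) (c lam / d lam) := by
    simpa using (hlam 0).hahnWeight hα
  refine ⟨⟨_, MVHermite.isMonicOrthogonal_monicHermite hN hν0,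
      fun _ hP => hP.eq_monicHermite hN hν0⟩,
    ⟨_, MVHermite.isMonicOrthogonal_monicHermite hN hlam0,
      fun _ hQ => hQ.eq_monicHermite hN hlam0⟩, ?_⟩
  intro P Q hP hQ n
  rw [hP.eq_monicHermite hN hν0, hQ.eq_monicHermite hN hlam0]
  exact MVHermite.monicHermite_eq_sum (q := fun μ => c μ / d μ) hα
    (fun p => div_pos (hν p).c_pos (hν p).d_pos) (fun p => div_pos (hlam p).c_pos (hlam p).d_pos)
    (fun h2 => MVHermite.ratio_add_nat h2 hα hν) (fun h2 => MVHermite.ratio_add_nat h2 hα hlam) n
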